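/- **Setting.** Let $D=\overline{B_1(0)}\subset\mathbb C$ be the closed unit disc and let $\Phi=\{f_1,\dots,f_n\}$ be a uniformly contracting holomorphic IFS on $D$: each $f_i$ is holomorphic on a neighbourhood of $D$, injective on $D$, satisfies $f_i(D)\subseteq D$, and $$0<\inf\{|f_i'(x)|:\ i\le n,\ x\in D\}\le \sup\{|f_i'(x)|:\ i\le n,\ x\in D\}<1 .$$ Let $K=K_\Phi\subseteq D$ be its attractor, i.e. the unique nonempty compact set with $K=\bigcup_i f_i(K)$. For a word $\eta=(\eta_1,\dots,\eta_k)$ write $f_\eta=f_{\eta_1}\circ\dots\circ f_{\eta_k}$. Suppose that $n\ge 4$ and that, after relabelling the maps: 1. (Separation) $f_i(D)\cap f_{i+1}(D)=\emptyset$ for $i=1,3$; and for every $k\ge5$ there is $i\in\{1,3\}$ such that $f_i(D),f_{i+1}(D),f_k(D)$ are pairwise disjoint. 2. (UNI) There are $m,m',\tilde C>0$ such that $|\nabla\log|f_\eta'|(x)|\le\tilde C$ for all finite words $\eta$ and all $x\in D$; for $i=1,3$ and all $x\in D$, $$m\le\big|\nabla\big(\log|f_i'|-\log|f_{i+1}'|\big)(x)\big|\le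 m';$$ and $m-2\tilde C\max_{i}\|f_i'\|_{\infty}>0$, where $\|\cdot\|_\infty$ is the supremum norm over $D$. Suppose moreover that $K$ is not contained in an analytic curve, where an analytic curve means a one-dimensional embedded real-analytic submanifold of the plane, not necessarily closed or connected. Let $\mathbf p=(p_1,\dots,p_n)$ be a probability vector with all $p_i>0$, with corresponding self-conformal measure $\nu=\nu_{\mathbf p}$ (the unique Borel probability measure on $K$ with $\nu=\sum_i p_i f_i\nu$). For $s\in\mathbb C$ and $\ell\in\mathbb Z$ define the transfer operator on $C^1(D)=C^1(D,\mathbb C)$ by $$P_{s,\ell}\,g(x)=\sum_{j=1}^n p_j\,e^{2\pi s\,c(j,x)}\,e^{\mathrm i\ell\,\theta(j,x)}\,g(f_j(x)),\qquad c(j,x)=-\log|f_j'(x)|,\quad \theta(j,x)=\arg f_j'(x),$$ and let $\|g\|_{C^1}=\sup_D|g|+\sup_D|\nabla g|$, where $|\nabla g|$ is the operator norm of the real Jacobian. **Theorem.** There are constants $C,\gamma,\epsilon,R>0$ and $0<\alpha<1$ (depending on $\Phi$ and $\mathbf p$) such that for all $a,b\in\mathbb R$ and $\ell\in\mathbb Z$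 with $|a|<\epsilon$ and $|b|+|\ell|>R$, and all integers $N>0$, the operator $P_{a+\mathrm ib,\ell}^N$ maps $C^1(D)$ to itself and $$\|P_{a+\mathrm ib,\ell}^{\,N}\|_{C^1}\le C\,(|b|+|\ell|)^{1+\gamma}\,\alpha^N,$$ where the left-hand side is the operator norm on $(C^1(D),\|\cdot\|_{C^1})$. -/

import Mathlib

namespace ConformalIFS

/-- The closed unit disc `D`. -/
def closedDisc : Set ℂ := Metric.closedBall 0 1

/-- A uniformly contracting holomorphic IFS on `D`: finitely many injective self-maps of `D`, each
holomorphic on a neighbourhood of `D`, with `0 < inf |f_i'|` and `sup |f_i'| < 1` over `D`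
(as `D` is convex, each map is then a strict contraction of `D`). -/
structure IsHolomorphicIFS {n : ℕ} (f : Fin n → ℂ → ℂ) : Prop where
  holo : ∀ i, AnalyticOnNhd ℂ (f i) closedDisc
  injOn : ∀ i, Set.InjOn (f i) closedDisc
  mapsTo : ∀ i, Set.MapsTo (f i) closedDisc closedDisc
  uniformlyContracting : ∃ r₁ r₂ : ℝ, 0 < r₁ ∧ r₂ < 1 ∧
    ∀ i, ∀ x ∈ closedDisc, r₁ ≤ ‖deriv (f i) x‖ ∧ ‖deriv (f i) x‖ ≤ r₂

/-- `K` is the attractor of the IFS: the (unique) nonempty compact `K ⊆ D` with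
`K = ⋃ i, f_i(K)`. -/
structure IsAttractor {n : ℕ} (f : Fin n → ℂ → ℂ) (K : Set ℂ) : Prop where
  nonempty : K.Nonempty
  isCompact : IsCompact K
  subset : K ⊆ closedDisc
  eq_iUnion : K = ⋃ i, f i '' K

/-- A planar analytic curve: a one-dimensional embedded real-analytic submanifold of the plane
(not necessarily closed or connected), that is, a set which near each of its points is the
zero set of a real-analytic function whose differential does not vanish at that point. -/
def IsAnalyticCurve (M : Set ℂ) : Prop :=
  ∀ z ∈ M, ∃ (V : Set ℂ) (u : ℂ → ℝ), IsOpen V ∧ z ∈ V ∧ AnalyticOnNhd ℝ u V ∧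
    fderiv ℝ u z ≠ 0 ∧ M ∩ V = {w ∈ V | u w = 0}

/-- The composition `f_{η₁} ∘ ⋯ ∘ f_{η_m}` along a finite word `η`. -/
def wordMap {n : ℕ} (f : Fin n → ℂ → ℂ) (η : List (Fin n)) : ℂ → ℂ :=
  η.foldr (fun i g => f i ∘ g) id

/-- The function `x ↦ log |g'(x)|`. -/
noncomputable def logAbsDeriv (g : ℂ → ℂ) (x : ℂ) : ℝ := Real.log ‖deriv g x‖

/-- `max_i ‖f_i'‖_∞`, the supremum norm being taken over `D`. -/
noncomputable def maxDeriv {n : ℕ} (f : Fin n → ℂ → ℂ) : ℝ :=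
  sSup {r : ℝ | ∃ i, ∃ x ∈ closedDisc, r = ‖deriv (f i) x‖}

/-- Separation, for the four distinguished maps `f_{j 0}, f_{j 1}` (first pair) and
`f_{j 2}, f_{j 3}` (second pair): the images of `D` under the two maps of each pair are disjoint,
and for every other index `k` the image `f_k(D)` is disjoint from both images of one of
the two pairs. -/
def Separated {n : ℕ} (f : Fin n → ℂ → ℂ) (j : Fin 4 → Fin n) : Prop :=
  Disjoint (f (j 0) '' closedDisc) (f (j 1) '' closedDisc) ∧
  Disjoint (f (j 2) '' closedDisc) (f (j 3) '' closedDisc) ∧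
  ∀ k, k ∉ Set.range j →
    (Disjoint (f k '' closedDisc) (f (j 0) '' closedDisc) ∧
      Disjoint (f k '' closedDisc) (f (j 1) '' closedDisc)) ∨
    (Disjoint (f k '' closedDisc) (f (j 2) '' closedDisc) ∧
      Disjoint (f k '' closedDisc) (f (j 3) '' closedDisc))

/-- Uniform non-integrability (UNI) for the two distinguished pairs. Here `Ct` is a bound for
`|∇ log |f_η'||` over `D`, uniform in all finite words `η`. -/
def UNI {n : ℕ} (f : Fin n → ℂ → ℂ) (j : Fin 4 → Fin n) : Prop :=
  ∃ m m' Ct : ℝ, 0 < m ∧ 0 < m' ∧ 0 < Ct ∧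
    (∀ η : List (Fin n), ∀ x ∈ closedDisc, ‖gradient (logAbsDeriv (wordMap f η)) x‖ ≤ Ct) ∧
    (∀ x ∈ closedDisc,
      m ≤ ‖gradient (fun y => logAbsDeriv (f (j 0)) y - logAbsDeriv (f (j 1)) y) x‖ ∧
      ‖gradient (fun y => logAbsDeriv (f (j 0)) y - logAbsDeriv (f (j 1)) y) x‖ ≤ m') ∧
    (∀ x ∈ closedDisc,
      m ≤ ‖gradient (fun y => logAbsDeriv (f (j 2)) y - logAbsDeriv (f (j 3)) y) x‖ ∧
      ‖gradient (fun y => logAbsDeriv (f (j 2)) y - logAbsDeriv (f (j 3)) y) x‖ ≤ m') ∧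
    0 < m - 2 * Ct * maxDeriv f

/-- The norm cocycle `c(g, x) = -log |g'(x)|`. -/
noncomputable def normCocycle (g : ℂ → ℂ) (x : ℂ) : ℝ := -Real.log ‖deriv g x‖

/-- The angle cocycle `θ(g, x) = arg g'(x)`. -/
noncomputable def angleCocycle (g : ℂ → ℂ) (x : ℂ) : ℝ := Complex.arg (deriv g x)

/-- The transfer operator
`(P_{s,ℓ} g)(x) = ∑ₐ pₐ exp(2π s c(a,x)) (exp(i θ(a,x)))^ℓ g(f_a(x))`. -/
noncomputable def transfer {n : ℕ} (f : Fin n → ℂ → ℂ) (p : Fin n → ℝ) (s : ℂ) (ℓ : ℤ)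
    (g : ℂ → ℂ) : ℂ → ℂ := fun x =>
  ∑ a, (p a : ℂ) * (Complex.exp (2 * (Real.pi : ℂ) * s * (normCocycle (f a) x : ℂ)) *
    (Complex.exp (Complex.I * (angleCocycle (f a) x : ℂ))) ^ ℓ * g (f a x))

/-- `g ∈ C¹(D)` (complex-valued, continuously real-differentiable up to the boundary). Only the
values of `g` on `D` matter. -/
def IsC1 (g : ℂ → ℂ) : Prop := ContDiffOn ℝ 1 g closedDisc

/-- The norm `‖g‖_{C¹} = ‖g‖_∞ + ‖∇g‖_∞` on `C¹(D)`; here `|∇g|` is the operator norm of the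
real differential. -/
noncomputable def c1Norm (g : ℂ → ℂ) : ℝ :=
  sSup ((fun x => ‖g x‖) '' closedDisc) +
    sSup ((fun x => ‖fderivWithin ℝ g closedDisc x‖) '' closedDisc)

/-- `T` maps `C¹(D)` to itself, with operator norm at most `B` for `‖·‖_{C¹}`. -/
def C1OpNormLE (T : (ℂ → ℂ) → (ℂ → ℂ)) (B : ℝ) : Prop :=
  ∀ g, IsC1 g → IsC1 (T g) ∧ c1Norm (T g) ≤ B * c1Norm g

end ConformalIFS

/-!
The proof is Dolgopyat's method, run on words instead of a measure.

Write `T = |b| + |ℓ|`. The maps extend to a slightly larger disc, where their derivatives have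
holomorphic logarithms; `wlog` is the logarithm of the derivative of a word, so that `P^N g` is an
average over words `w` of length `N` of `exp (twist (wlog w)) · g ∘ w`, and `twist` is
real-linear with imaginary part `Re (β ·)` for a frequency `β` of size comparable to `T`
(`IsLogIFS.transfer_iterate_eq`, `twist_im`). A function `u` is followed together with a positive
majorant `H`, where `log H` is `O(T)`-Lipschitz and `H` controls the increments of `u` at scale
`1 / T` (`Dominated`). The weights `p` are constant and sum to `1`, so `P^N` is
dominated by the averaging operator `avg^N`, up to a factor `e^{O(|a| N)}` which is absorbed by the
gain below when `|a|` is small.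

The gain comes from two words `v₁, v₂` of a fixed length `N` with innermost letters `j 0` and `j 1`.
By (UNI), `wlog v₁ - wlog v₂` is holomorphic with derivative bounded below uniformly in `N`
(`IsLogIFS.exists_le_norm_deriv_sub`), so the relative phase of the two branches has a gradient of
size comparable to `T`, in some direction. As `K` lies on no analytic curve, every cylinder has
comparable width in all directions (`IsLogIFS.exists_nonconcentration`): otherwise rescaled
words would accumulate, by normality, at a holomorphic map with nonvanishing derivative taking `K`
into a line. Hence in every cylinder of size comparable to `1 / T` the relative phase varies by a
definite amount between two points of `K`, while `u` composed with words of length `N` varies much less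
when `N` is large, so the two branches cancel near one of these points
(`IsLogIFS.exists_cancellation`).

Replacing the two branches in `avg^N H` by `pairMajorant` gives a majorant `H'` of `P^N u` of the
same regularity, and `H'^2` is smaller by a definite factor than `avg^N (H^2)` where
the branches cancel. That region contains a subcylinder of bounded relative depth in each cylinder
of size comparable to `1 / T`; cutting words at this scale shows that `avg^M (H'^2)` is at most
`(1 - d) avg^(M + N) (H^2)` when `M` exceeds a constant multiple of `log T`
(`IsLogIFS.le_avg_indicator`, `IsLogIFS.exists_step`). Iterating, and applying a
final power of `P` of length about `log T`, yields exponentially small bounds for the supremum of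
`P^N g` and, with a loss of a factor `T`, for its increments. The length of the final power
accounts for the factor `T^γ`.
-/

namespace ConformalIFS

open Metric Set Filter Topology

variable {n : ℕ} {f L : Fin n → ℂ → ℂ} {ε r B c : ℝ} {p : Fin n → ℝ}

/-! ### Logarithms of the derivatives of words -/

/-- Holomorphic logarithms `L a` of the derivatives `f_a'` on the disc of radius `1 + ε`, which all
the maps `f_a` send into itself, together with uniform bounds: `|f_a'| ≤ r < 1`, `|f_a'| ≥ e^{-c}`
and `|L_a'| ≤ B`. -/
structure IsLogIFS (f L : Fin n → ℂ → ℂ) (ε r B c : ℝ) : Prop where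
  eps_pos : 0 < ε
  r_pos : 0 < r
  r_lt : r < 1
  B_nonneg : 0 ≤ B
  diff : ∀ a, DifferentiableOn ℂ (f a) (ball 0 (1 + ε))
  diffL : ∀ a, DifferentiableOn ℂ (L a) (ball 0 (1 + ε))
  deriv_eq : ∀ a, ∀ x ∈ ball (0 : ℂ) (1 + ε), deriv (f a) x = Complex.exp (L a x)
  norm_le : ∀ a, ∀ x ∈ ball (0 : ℂ) (1 + ε), ‖Complex.exp (L a x)‖ ≤ r
  le_re : ∀ a, ∀ x ∈ ball (0 : ℂ) (1 + ε), -c ≤ (L a x).re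
  derivL : ∀ a, ∀ x ∈ ball (0 : ℂ) (1 + ε), ‖deriv (L a) x‖ ≤ B
  mapsU : ∀ a, MapsTo (f a) (ball 0 (1 + ε)) (ball 0 (1 + ε))
  mapsD : ∀ a, MapsTo (f a) closedDisc closedDisc

/-- The composition of the maps of a word, the head of the word being applied first. This is
the order in which words appear in the iterates of the transfer operator. -/
def wcomp (f : Fin n → ℂ → ℂ) : List (Fin n) → ℂ → ℂ
  | [], x => x
  | a :: w, x => wcomp f w (f a x)

/-- The logarithm of the derivative of `wcomp f w`, as a Birkhoff sum of the `L a`. -/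
def wlog (f L : Fin n → ℂ → ℂ) : List (Fin n) → ℂ → ℂ
  | [], _ => 0
  | a :: w, x => L a x + wlog f L w (f a x)

lemma wcomp_append (u v : List (Fin n)) (x : ℂ) :
    wcomp f (u ++ v) x = wcomp f v (wcomp f u x) := by
  induction u generalizing x with
  | nil => rfl
  | cons a u ih => simp [wcomp, ih]

lemma wordMap_eq_wcomp (η : List (Fin n)) : wordMap f η.reverse = wcomp f η := by
  induction η with
  | nil => rfl
  | cons a w ih =>
    funext x
    have h : ∀ (l : List (Fin n)) (y : ℂ), wordMap f (l ++ [a]) y = wordMap f l (f a y) := by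
      intro l
      induction l with
      | nil => intro y; rfl
      | cons b l ihl =>
        intro y
        change f b (wordMap f (l ++ [a]) y) = f b (wordMap f l (f a y))
        rw [ihl]
    rw [List.reverse_cons, h, ih]
    rfl

lemma zero_mem_closedDisc : (0 : ℂ) ∈ closedDisc := by simp [closedDisc]

lemma convex_closedDisc : Convex ℝ closedDisc := convex_closedBall _ _

lemma isCompact_closedDisc : IsCompact closedDisc := isCompact_closedBall _ _

namespace IsLogIFS

lemma isOpen_ball : IsOpen (ball (0 : ℂ) (1 + ε)) := Metric.isOpen_ball

lemma closedDisc_subset (h : IsLogIFS f L ε r B c) : closedDisc ⊆ ball 0 (1 + ε) :=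
  closedBall_subset_ball (by linarith [h.eps_pos])

lemma mapsD_wcomp (h : IsLogIFS f L ε r B c) (w : List (Fin n)) :
    MapsTo (wcomp f w) closedDisc closedDisc := by
  induction w with
  | nil => exact fun x hx => hx
  | cons a w ih => exact fun x hx => ih (h.mapsD a hx)

lemma hasDerivAt (h : IsLogIFS f L ε r B c) (a : Fin n) {x : ℂ} (hx : x ∈ ball (0 : ℂ) (1 + ε)) :
    HasDerivAt (f a) (Complex.exp (L a x)) x := by
  have := ((h.diff a).differentiableAt (isOpen_ball.mem_nhds hx)).hasDerivAt
  rwa [h.deriv_eq a x hx] at this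

lemma hasDerivAt_wcomp (h : IsLogIFS f L ε r B c) (w : List (Fin n)) {x : ℂ}
    (hx : x ∈ ball (0 : ℂ) (1 + ε)) :
    HasDerivAt (wcomp f w) (Complex.exp (wlog f L w x)) x := by
  induction w generalizing x with
  | nil => simpa [wlog] using! hasDerivAt_id x
  | cons a w ih =>
    have := (ih (h.mapsU a hx)).comp x (h.hasDerivAt a hx)
    rw [wlog, add_comm, Complex.exp_add]
    exact this

lemma differentiableOn_wlog (h : IsLogIFS f L ε r B c) (w : List (Fin n)) :
    DifferentiableOn ℂ (wlog f L w) (ball 0 (1 + ε)) := by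
  induction w with
  | nil => exact differentiableOn_const (0 : ℂ)
  | cons a w ih => exact (h.diffL a).add (ih.comp (h.diff a) (h.mapsU a))

lemma differentiableAt_wlog (h : IsLogIFS f L ε r B c) (w : List (Fin n)) {x : ℂ}
    (hx : x ∈ ball (0 : ℂ) (1 + ε)) : DifferentiableAt ℂ (wlog f L w) x :=
  (h.differentiableOn_wlog w).differentiableAt (isOpen_ball.mem_nhds hx)

lemma norm_exp_wlog_le (h : IsLogIFS f L ε r B c) (w : List (Fin n)) {x : ℂ}
    (hx : x ∈ ball (0 : ℂ) (1 + ε)) : ‖Complex.exp (wlog f L w x)‖ ≤ r ^ w.length := by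
  induction w generalizing x with
  | nil => simp [wlog]
  | cons a w ih =>
    rw [wlog, Complex.exp_add, norm_mul, List.length_cons, pow_succ, mul_comm]
    exact mul_le_mul (ih (h.mapsU a hx)) (h.norm_le a x hx) (norm_nonneg _)
      (pow_nonneg h.r_pos.le _)

lemma wlog_re_nonpos (h : IsLogIFS f L ε r B c) (w : List (Fin n)) {x : ℂ}
    (hx : x ∈ ball (0 : ℂ) (1 + ε)) : (wlog f L w x).re ≤ 0 := by
  have h1 := (h.norm_exp_wlog_le w hx).trans (pow_le_one₀ h.r_pos.le h.r_lt.le)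
  rw [Complex.norm_exp] at h1
  exact Real.exp_le_one_iff.mp h1

lemma c_nonneg (h : IsLogIFS f L ε r B c) (a : Fin n) : 0 ≤ c := by
  have h0 : (0 : ℂ) ∈ ball (0 : ℂ) (1 + ε) := h.closedDisc_subset zero_mem_closedDisc
  have h1 := h.wlog_re_nonpos [a] h0
  have h2 := h.le_re a 0 h0
  simp only [wlog, add_zero] at h1
  linarith

lemma le_wlog_re (h : IsLogIFS f L ε r B c) (w : List (Fin n)) {x : ℂ}
    (hx : x ∈ ball (0 : ℂ) (1 + ε)) : -(c * w.length) ≤ (wlog f L w x).re := by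
  induction w generalizing x with
  | nil => simp [wlog]
  | cons a w ih =>
    have := ih (h.mapsU a hx)
    have h2 := h.le_re a x hx
    simp only [wlog, Complex.add_re, List.length_cons]
    push_cast
    linarith

lemma norm_f_sub_le (h : IsLogIFS f L ε r B c) (a : Fin n) {x y : ℂ}
    (hx : x ∈ ball (0 : ℂ) (1 + ε)) (hy : y ∈ ball (0 : ℂ) (1 + ε)) :
    ‖f a x - f a y‖ ≤ r * ‖x - y‖ :=
  (convex_ball (0 : ℂ) (1 + ε)).norm_image_sub_le_of_norm_hasDerivWithin_le
    (fun _ hz => (h.hasDerivAt a hz).hasDerivWithinAt) (fun z hz => h.norm_le a z hz) hy hx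

lemma norm_wcomp_sub_le (h : IsLogIFS f L ε r B c) (w : List (Fin n)) {x y : ℂ}
    (hx : x ∈ ball (0 : ℂ) (1 + ε)) (hy : y ∈ ball (0 : ℂ) (1 + ε)) :
    ‖wcomp f w x - wcomp f w y‖ ≤ r ^ w.length * ‖x - y‖ :=
  (convex_ball (0 : ℂ) (1 + ε)).norm_image_sub_le_of_norm_hasDerivWithin_le
    (fun _ hz => (h.hasDerivAt_wcomp w hz).hasDerivWithinAt)
    (fun _ hz => h.norm_exp_wlog_le w hz) hy hx

lemma distortion_nonneg (h : IsLogIFS f L ε r B c) : 0 ≤ B / (1 - r) :=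
  div_nonneg h.B_nonneg (by linarith [h.r_lt])

/-- Bounded distortion: the logarithmic derivatives of all words are equi-Lipschitz. -/
lemma norm_wlog_sub_le (h : IsLogIFS f L ε r B c) (w : List (Fin n)) {x y : ℂ}
    (hx : x ∈ ball (0 : ℂ) (1 + ε)) (hy : y ∈ ball (0 : ℂ) (1 + ε)) :
    ‖wlog f L w x - wlog f L w y‖ ≤ B / (1 - r) * ‖x - y‖ := by
  induction w generalizing x y with
  | nil => simpa [wlog] using mul_nonneg h.distortion_nonneg (norm_nonneg _)
  | cons a w ih =>
    have h1 : ‖L a x - L a y‖ ≤ B * ‖x - y‖ :=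
      (convex_ball (0 : ℂ) (1 + ε)).norm_image_sub_le_of_norm_deriv_le
        (fun _ hz => (h.diffL a).differentiableAt (isOpen_ball.mem_nhds hz))
        (fun z hz => h.derivL a z hz) hy hx
    have h2 := (ih (h.mapsU a hx) (h.mapsU a hy)).trans
      (mul_le_mul_of_nonneg_left (h.norm_f_sub_le a hx hy) h.distortion_nonneg)
    have h3 : wlog f L (a :: w) x - wlog f L (a :: w) y =
        (L a x - L a y) + (wlog f L w (f a x) - wlog f L w (f a y)) := by
      simp only [wlog]; ring
    have h4 : B = B / (1 - r) * (1 - r) := by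
      field_simp [show (1 - r) ≠ 0 by linarith [h.r_lt]]
    rw [h3]
    calc _ ≤ _ := norm_add_le _ _
      _ ≤ B * ‖x - y‖ + B / (1 - r) * (r * ‖x - y‖) := add_le_add h1 h2
      _ = B / (1 - r) * (1 - r) * ‖x - y‖ + B / (1 - r) * (r * ‖x - y‖) := by rw [← h4]
      _ = _ := by ring

lemma norm_exp_wlog_le_zero (h : IsLogIFS f L ε r B c) (w : List (Fin n)) {x : ℂ}
    (hx : x ∈ closedDisc) :
    ‖Complex.exp (wlog f L w x)‖ ≤
      Real.exp (B / (1 - r)) * ‖Complex.exp (wlog f L w 0)‖ := by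
  have h1 := h.norm_wlog_sub_le w (h.closedDisc_subset hx)
    (h.closedDisc_subset zero_mem_closedDisc)
  have h2 : ‖x - 0‖ ≤ 1 := by simpa [closedDisc] using hx
  have h3 := (Complex.re_le_norm _).trans
    (h1.trans (mul_le_mul_of_nonneg_left h2 h.distortion_nonneg))
  rw [Complex.norm_exp, Complex.norm_exp, ← Real.exp_add]
  apply Real.exp_le_exp.mpr
  rw [Complex.sub_re] at h3
  linarith

lemma norm_wcomp_sub_le_deriv (h : IsLogIFS f L ε r B c) (w : List (Fin n)) {x y : ℂ}
    (hx : x ∈ closedDisc) (hy : y ∈ closedDisc) :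
    ‖wcomp f w x - wcomp f w y‖ ≤
      Real.exp (B / (1 - r)) * ‖Complex.exp (wlog f L w 0)‖ * ‖x - y‖ :=
  convex_closedDisc.norm_image_sub_le_of_norm_hasDerivWithin_le
    (fun _ hz => (h.hasDerivAt_wcomp w (h.closedDisc_subset hz)).hasDerivWithinAt)
    (fun _ hz => h.norm_exp_wlog_le_zero w hz) hy hx

/-- Passing from a word to a child shrinks the derivative at most by a fixed factor. -/
lemma norm_exp_wlog_cons_ge (h : IsLogIFS f L ε r B c) (a : Fin n) (w : List (Fin n)) :
    Real.exp (-c - B / (1 - r)) * ‖Complex.exp (wlog f L w 0)‖ ≤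
      ‖Complex.exp (wlog f L (a :: w) 0)‖ := by
  have h0 := zero_mem_closedDisc
  have hU := h.closedDisc_subset h0
  have h1 := h.norm_wlog_sub_le w hU (h.mapsU a hU)
  have h2 : ‖(0 : ℂ) - f a 0‖ ≤ 1 := by simpa [closedDisc] using h.mapsD a h0
  have h3 := (Complex.re_le_norm _).trans
    (h1.trans (mul_le_mul_of_nonneg_left h2 h.distortion_nonneg))
  have h4 := h.le_re a 0 hU
  rw [Complex.norm_exp, Complex.norm_exp, ← Real.exp_add]
  apply Real.exp_le_exp.mpr
  rw [Complex.sub_re] at h3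
  simp only [wlog, Complex.add_re]
  linarith

end IsLogIFS

/-! ### Existence of the logarithms -/

/-- A nonvanishing holomorphic function on a disc has a holomorphic logarithm. -/
lemma exists_log_on_ball {g : ℂ → ℂ} {R : ℝ} (hR : 0 < R) (hg : DifferentiableOn ℂ g (ball 0 R))
    (h0 : ∀ x ∈ ball (0 : ℂ) R, g x ≠ 0) :
    ∃ Q : ℂ → ℂ, DifferentiableOn ℂ Q (ball 0 R) ∧
      ∀ x ∈ ball (0 : ℂ) R, Complex.exp (Q x) = g x := by
  have hd : DifferentiableOn ℂ (fun x => deriv g x / g x) (ball 0 R) :=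
    (hg.deriv isOpen_ball).div hg h0
  obtain ⟨Q, hQ0, hQ⟩ := hd.isExactOn_ball.with_val_at (0 : ℂ) (Complex.log (g 0))
  refine ⟨Q, fun x hx => (hQ x hx).differentiableAt.differentiableWithinAt, fun x hx => ?_⟩
  have hder : ∀ y ∈ ball (0 : ℂ) R, HasDerivAt (fun x => g x * Complex.exp (-Q x)) 0 y := by
    intro y hy
    have h1 := ((hg.differentiableAt (isOpen_ball.mem_nhds hy)).hasDerivAt).mul (hQ y hy).neg.cexp
    have h2 := h0 y hy
    have h3 : deriv g y * Complex.exp (-Q y) +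
        g y * (Complex.exp (-Q y) * -(deriv g y / g y)) = 0 := by
      field_simp
      ring
    rw [← h3]
    exact h1
  have hmem : (0 : ℂ) ∈ ball (0 : ℂ) R := mem_ball_self hR
  have hconst := (convex_ball (0 : ℂ) R).norm_image_sub_le_of_norm_hasDerivWithin_le
    (C := 0) (fun y hy => (hder y hy).hasDerivWithinAt) (by simp) hmem hx
  simp only [zero_mul, norm_le_zero_iff, sub_eq_zero] at hconst
  rw [hQ0, Complex.exp_neg, Complex.exp_neg, Complex.exp_log (h0 0 hmem),
    mul_inv_cancel₀ (h0 0 hmem), mul_inv_eq_one₀ (Complex.exp_ne_zero _)] at hconst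
  exact hconst.symm

theorem IsHolomorphicIFS.exists_isLogIFS (hf : IsHolomorphicIFS f) :
    ∃ (L : Fin n → ℂ → ℂ) (ε r B c : ℝ), IsLogIFS f L ε r B c := by
  obtain ⟨r₁, r₂, h1, h2, hr⟩ := hf.uniformlyContracting
  set r := max ((1 + r₂) / 2) (1 / 2) with hrdef
  have hr0 : 0 < r := lt_of_lt_of_le (by norm_num) (le_max_right _ _)
  have hr1 : r < 1 := max_lt (by linarith) (by norm_num)
  have hr2 : r₂ < r := lt_of_lt_of_le (by linarith) (le_max_left _ _)
  -- a common larger disc on which all the maps are holomorphic with controlled derivative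
  have key : ∀ a, ∀ᶠ δ in 𝓝[>] (0 : ℝ), ∀ x ∈ ball (0 : ℂ) (1 + δ),
      AnalyticAt ℂ (f a) x ∧ r₁ / 2 < ‖deriv (f a) x‖ ∧ ‖deriv (f a) x‖ < r := by
    intro a
    have hopen : IsOpen {x : ℂ | AnalyticAt ℂ (f a) x ∧ r₁ / 2 < ‖deriv (f a) x‖ ∧
        ‖deriv (f a) x‖ < r} := by
      rw [isOpen_iff_mem_nhds]
      rintro x ⟨hx1, hx2, hx3⟩
      have hc := hx1.deriv.continuousAt.norm
      filter_upwards [hx1.eventually_analyticAt, hc.eventually_const_lt hx2,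
        hc.eventually_lt_const hx3] with y e1 e2 e3 using ⟨e1, e2, e3⟩
    have hsub : closedDisc ⊆ {x : ℂ | AnalyticAt ℂ (f a) x ∧ r₁ / 2 < ‖deriv (f a) x‖ ∧
        ‖deriv (f a) x‖ < r} := fun x hx =>
      ⟨hf.holo a x hx, by linarith [(hr a x hx).1], by linarith [(hr a x hx).2]⟩
    obtain ⟨δ, hδ, hsubδ⟩ := isCompact_closedDisc.exists_thickening_subset_open hopen hsub
    rw [closedDisc, thickening_closedBall hδ zero_le_one] at hsubδ
    have hlt : ∀ᶠ δ' in 𝓝[>] (0 : ℝ), δ' < δ :=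
      mem_nhdsWithin_of_mem_nhds (eventually_lt_nhds hδ)
    filter_upwards [hlt] with δ' hδ' x hx
    exact hsubδ (ball_subset_ball (by linarith) hx)
  obtain ⟨δ, hδ, hδ0⟩ := ((eventually_all.2 key).and self_mem_nhdsWithin).exists
  have hδ0 : 0 < δ := hδ0
  have hlog : ∀ a, ∃ Q : ℂ → ℂ, DifferentiableOn ℂ Q (ball 0 (1 + δ)) ∧
      ∀ x ∈ ball (0 : ℂ) (1 + δ), Complex.exp (Q x) = deriv (f a) x := by
    intro a
    refine exists_log_on_ball (by linarith) (fun x hx =>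
      (hδ a x hx).1.deriv.differentiableAt.differentiableWithinAt) (fun x hx h => ?_)
    have := (hδ a x hx).2.1
    rw [h, norm_zero] at this
    linarith
  choose L hL1 hL2 using hlog
  have hcl : closedBall (0 : ℂ) (1 + δ / 2) ⊆ ball 0 (1 + δ) :=
    closedBall_subset_ball (by linarith)
  have hU : ball (0 : ℂ) (1 + δ / 2) ⊆ ball 0 (1 + δ) := ball_subset_ball (by linarith)
  have hB : ∀ a, ∃ B : ℝ, ∀ x ∈ closedBall (0 : ℂ) (1 + δ / 2), ‖deriv (L a) x‖ ≤ B := fun a =>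
    (isCompact_closedBall (0 : ℂ) (1 + δ / 2)).exists_bound_of_continuousOn
      (((hL1 a).deriv isOpen_ball).continuousOn.mono hcl)
  choose B hB using hB
  refine ⟨L, δ / 2, r, ∑ a, |B a|, -Real.log (r₁ / 2), by linarith, hr0, hr1,
    Finset.sum_nonneg fun _ _ => abs_nonneg _, ?_, ?_, ?_, ?_, ?_, ?_, ?_, ?_⟩
  · exact fun a x hx => (hδ a x (hU hx)).1.differentiableAt.differentiableWithinAt
  · exact fun a => (hL1 a).mono hU
  · exact fun a x hx => (hL2 a x (hU hx)).symm
  · intro a x hx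
    rw [hL2 a x (hU hx)]
    exact (hδ a x (hU hx)).2.2.le
  · intro a x hx
    have := (hδ a x (hU hx)).2.1
    rw [← hL2 a x (hU hx), Complex.norm_exp] at this
    rw [neg_neg]
    have h3 := Real.log_lt_log (by positivity) this
    rw [Real.log_exp] at h3
    exact h3.le
  · exact fun a x hx => (hB a x (ball_subset_closedBall hx)).trans ((le_abs_self _).trans
      (Finset.single_le_sum (f := fun a => |B a|) (fun _ _ => abs_nonneg _) (Finset.mem_univ a)))
  · -- the contraction moves a point at distance `< ε` from the disc to distance `< ε`
    intro a x hx
    set t : ℝ := (1 + δ / 2)⁻¹ with ht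
    have ht0 : 0 < t := by positivity
    have htt : t * (1 + δ / 2) = 1 := inv_mul_cancel₀ (by positivity)
    have hx' : ‖x‖ < 1 + δ / 2 := by simpa using hx
    have hx0 : (t : ℂ) * x ∈ closedDisc := by
      simp only [closedDisc, mem_closedBall, dist_zero_right, norm_mul, Complex.norm_real,
        Real.norm_eq_abs, abs_of_pos ht0]
      nlinarith
    have hd : ‖x - t * x‖ ≤ δ / 2 := by
      have : x - t * x = ((1 - t : ℝ) : ℂ) * x := by push_cast; ring
      rw [this, norm_mul, Complex.norm_real, Real.norm_eq_abs,
        abs_of_nonneg (by nlinarith : (0 : ℝ) ≤ 1 - t)]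
      have : 0 ≤ 1 - t := by nlinarith
      nlinarith
    have hx0U : (t : ℂ) * x ∈ ball (0 : ℂ) (1 + δ / 2) :=
      closedBall_subset_ball (by linarith) hx0
    have h3 : ‖f a x - f a (t * x)‖ ≤ r * ‖x - t * x‖ :=
      (convex_ball (0 : ℂ) (1 + δ / 2)).norm_image_sub_le_of_norm_deriv_le
        (fun z hz => (hδ a z (hU hz)).1.differentiableAt)
        (fun z hz => (hδ a z (hU hz)).2.2.le) hx0U hx
    have h4 : ‖f a (t * x)‖ ≤ 1 := by simpa [closedDisc] using hf.mapsTo a hx0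
    have h5 : ‖f a x‖ ≤ ‖f a x - f a (t * x)‖ + ‖f a (t * x)‖ := by
      simpa using norm_add_le (f a x - f a (t * x)) (f a (t * x))
    rw [mem_ball_zero_iff]
    nlinarith [norm_nonneg (x - t * x)]
  · exact hf.mapsTo

/-! ### Uniform non-integrability in terms of the logarithms -/

lemma norm_gradient_re {F : ℂ → ℂ} {g : ℂ → ℝ} {x : ℂ} (hF : DifferentiableAt ℂ F x)
    (hg : g =ᶠ[𝓝 x] fun y => (F y).re) : ‖gradient g x‖ = ‖deriv F x‖ := by
  have h1 : HasFDerivAt g (Complex.reCLM.comp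
      ((ContinuousLinearMap.toSpanSingleton ℂ (deriv F x)).restrictScalars ℝ)) x := by
    have := (Complex.reCLM.hasFDerivAt (x := F x)).comp x
      (hF.hasDerivAt.hasFDerivAt.restrictScalars ℝ)
    exact this.congr_of_eventuallyEq hg
  rw [gradient, h1.fderiv, LinearIsometryEquiv.norm_map]
  apply le_antisymm
  · refine ContinuousLinearMap.opNorm_le_bound _ (norm_nonneg _) fun y => ?_
    simp only [ContinuousLinearMap.comp_apply, ContinuousLinearMap.coe_restrictScalars',
      ContinuousLinearMap.toSpanSingleton_apply, smul_eq_mul, Complex.reCLM_apply,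
      Real.norm_eq_abs]
    exact (Complex.abs_re_le_norm _).trans (by rw [norm_mul, mul_comm])
  · -- the bound is attained in the direction `conj (F' x)`
    set d := deriv F x
    by_cases hd : d = 0
    · simp [hd]
    have h2 := ContinuousLinearMap.le_opNorm (Complex.reCLM.comp
      ((ContinuousLinearMap.toSpanSingleton ℂ d).restrictScalars ℝ)) ((starRingEnd ℂ) d)
    simp only [ContinuousLinearMap.comp_apply, ContinuousLinearMap.coe_restrictScalars',
      ContinuousLinearMap.toSpanSingleton_apply, smul_eq_mul, Complex.reCLM_apply,
      Real.norm_eq_abs, RCLike.norm_conj] at h2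
    rw [mul_comm, Complex.mul_conj, Complex.ofReal_re, Complex.normSq_eq_norm_sq,
      abs_of_nonneg (by positivity)] at h2
    have hpos : 0 < ‖d‖ := norm_pos_iff.mpr hd
    nlinarith

namespace IsLogIFS

lemma logAbsDeriv_wcomp (h : IsLogIFS f L ε r B c) (w : List (Fin n)) {x : ℂ}
    (hx : x ∈ ball (0 : ℂ) (1 + ε)) :
    logAbsDeriv (wcomp f w) x = (wlog f L w x).re := by
  rw [logAbsDeriv, (h.hasDerivAt_wcomp w hx).deriv, Complex.norm_exp, Real.log_exp]

lemma logAbsDeriv_eq (h : IsLogIFS f L ε r B c) (a : Fin n) {x : ℂ}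
    (hx : x ∈ ball (0 : ℂ) (1 + ε)) : logAbsDeriv (f a) x = (L a x).re := by
  rw [logAbsDeriv, h.deriv_eq a x hx, Complex.norm_exp, Real.log_exp]

lemma deriv_wlog_cons (h : IsLogIFS f L ε r B c) (a : Fin n) (w : List (Fin n)) {x : ℂ}
    (hx : x ∈ ball (0 : ℂ) (1 + ε)) :
    deriv (wlog f L (a :: w)) x =
      deriv (L a) x + deriv (wlog f L w) (f a x) * deriv (f a) x := by
  have h1 := ((h.diffL a).differentiableAt (isOpen_ball.mem_nhds hx)).hasDerivAt
  have h2 := ((h.differentiableAt_wlog w (h.mapsU a hx)).hasDerivAt).comp x (h.hasDerivAt a hx)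
  rw [h.deriv_eq a x hx]
  exact (h1.add h2).deriv

/-- Under (UNI) the logarithmic derivatives of any two words whose first letters form the first
distinguished pair have difference with derivative bounded below on `D`. -/
theorem exists_le_norm_deriv_sub (h : IsLogIFS f L ε r B c) {j : Fin 4 → Fin n} (huni : UNI f j) :
    ∃ m₁ : ℝ, 0 < m₁ ∧ ∀ (η : List (Fin n)), ∀ x ∈ closedDisc,
      m₁ ≤ ‖deriv (fun y => wlog f L (j 0 :: η) y - wlog f L (j 1 :: η) y) x‖ := by
  obtain ⟨m, m', Ct, hm, hm', hCt, hall, hpair, -, hpos⟩ := huni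
  refine ⟨_, hpos, fun η x hxD => ?_⟩
  have hx := h.closedDisc_subset hxD
  have hnhds := isOpen_ball.mem_nhds hx
  have hw : ∀ y ∈ closedDisc, ‖deriv (wlog f L η) y‖ ≤ Ct := by
    intro y hy
    have hyU := h.closedDisc_subset hy
    have h1 := hall η.reverse y hy
    rw [wordMap_eq_wcomp] at h1
    rwa [norm_gradient_re (h.differentiableAt_wlog η hyU)] at h1
    filter_upwards [isOpen_ball.mem_nhds hyU] with z hz using h.logAbsDeriv_wcomp η hz
  have hρ : ∀ a, ‖deriv (f a) x‖ ≤ maxDeriv f := by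
    intro a
    refine le_csSup ⟨r, ?_⟩ ⟨a, x, hxD, rfl⟩
    rintro _ ⟨b, y, hy, rfl⟩
    rw [h.deriv_eq b y (h.closedDisc_subset hy)]
    exact h.norm_le b y (h.closedDisc_subset hy)
  have hLd : ∀ a, DifferentiableAt ℂ (L a) x := fun a => (h.diffL a).differentiableAt hnhds
  have h2 : m ≤ ‖deriv (L (j 0)) x - deriv (L (j 1)) x‖ := by
    have h3 := (hpair x hxD).1
    rwa [norm_gradient_re (F := fun y => L (j 0) y - L (j 1) y) ((hLd _).sub (hLd _)),
      deriv_fun_sub (hLd _) (hLd _)] at h3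
    filter_upwards [hnhds] with z hz
    rw [h.logAbsDeriv_eq _ hz, h.logAbsDeriv_eq _ hz, Complex.sub_re]
  have h4 : ∀ a, ‖deriv (wlog f L η) (f a x) * deriv (f a) x‖ ≤ Ct * maxDeriv f := fun a => by
    rw [norm_mul]
    exact mul_le_mul (hw _ (h.mapsD a hxD)) (hρ a) (norm_nonneg _) hCt.le
  rw [deriv_fun_sub (h.differentiableAt_wlog _ hx) (h.differentiableAt_wlog _ hx),
    h.deriv_wlog_cons _ _ hx, h.deriv_wlog_cons _ _ hx]
  have h5 : ∀ u v p q : ℂ, ‖u - v‖ ≤ ‖u + p - (v + q)‖ + (‖p‖ + ‖q‖) := by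
    intro u v p q
    have : u - v = (u + p - (v + q)) - (p - q) := by ring
    rw [this]
    exact (norm_sub_le _ _).trans (add_le_add le_rfl (norm_sub_le _ _))
  have h6 := h5 (deriv (L (j 0)) x) (deriv (L (j 1)) x)
    (deriv (wlog f L η) (f (j 0) x) * deriv (f (j 0)) x)
    (deriv (wlog f L η) (f (j 1) x) * deriv (f (j 1)) x)
  linarith [h4 (j 0), h4 (j 1)]

end IsLogIFS

/-! ### Non-concentration of the attractor -/

/-- A pointwise limit of equi-Lipschitz functions on a set is a locally uniform limit. -/
lemma tendstoLocallyUniformlyOn_of_lipschitz {ι : Type*} {l : Filter ι} [l.NeBot]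
    {F : ι → ℂ → ℂ} {G : ℂ → ℂ} {U : Set ℂ} {C : ℝ} (hC : 0 < C)
    (hF : ∀ k, ∀ x ∈ U, ∀ y ∈ U, ‖F k x - F k y‖ ≤ C * ‖x - y‖)
    (hlim : ∀ x ∈ U, Tendsto (fun k => F k x) l (𝓝 (G x))) :
    TendstoLocallyUniformlyOn F G l U := by
  rw [Metric.tendstoLocallyUniformlyOn_iff]
  intro e he x hx
  refine ⟨U ∩ ball x (e / (4 * C)), inter_mem self_mem_nhdsWithin
    (mem_nhdsWithin_of_mem_nhds (ball_mem_nhds x (by positivity))), ?_⟩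
  have hG : ∀ y ∈ U, ‖G x - G y‖ ≤ C * ‖x - y‖ := fun y hy =>
    le_of_tendsto ((hlim x hx).sub (hlim y hy)).norm (Eventually.of_forall fun k => hF k x hx y hy)
  filter_upwards [(Metric.tendsto_nhds.mp (hlim x hx)) (e / 4) (by positivity)] with k hk y hy
  have hd : C * ‖x - y‖ ≤ e / 4 := by
    have h1 := hy.2
    rw [mem_ball, dist_comm, dist_eq_norm, lt_div_iff₀ (by positivity)] at h1
    linarith
  have h1 := hG y hy.1
  have h2 := hF k x hx y hy.1
  rw [dist_eq_norm] at hk ⊢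
  have h3 : G y - F k y = (F k x - F k y) - (G x - G y) - (F k x - G x) := by ring
  rw [h3]
  have h4 := norm_sub_le ((F k x - F k y) - (G x - G y)) (F k x - G x)
  have h5 := norm_sub_le (F k x - F k y) (G x - G y)
  linarith

/-- Level sets of the real part of a holomorphic function with nonvanishing derivative are
analytic curves. -/
lemma isAnalyticCurve_re_eq_zero {G : ℂ → ℂ} {U : Set ℂ} (hU : IsOpen U)
    (hG : DifferentiableOn ℂ G U) (hG' : ∀ z ∈ U, deriv G z ≠ 0) :
    IsAnalyticCurve {z ∈ U | (G z).re = 0} := by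
  intro z hz
  refine ⟨U, fun w => (G w).re, hU, hz.1, ?_, ?_, ?_⟩
  · exact Complex.reCLM.comp_analyticOnNhd (hG.analyticOnNhd hU).restrictScalars
  · intro h0
    have h1 := norm_gradient_re (hG.differentiableAt (hU.mem_nhds hz.1))
      (EventuallyEq.refl (𝓝 z) fun w => (G w).re)
    rw [gradient, h0, map_zero, norm_zero] at h1
    exact hG' z hz.1 (norm_eq_zero.mp h1.symm)
  · ext w
    simp only [mem_inter_iff, mem_ofPred_eq]
    tauto

/-- Non-concentration: as the attractor lies on no analytic curve, its pieces at all scales have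
comparable width in every direction. Otherwise rescaled words would accumulate at a
holomorphic map with nonvanishing derivative that sends `K` into a line. -/
theorem IsLogIFS.exists_nonconcentration (h : IsLogIFS f L ε r B c) {K : Set ℂ}
    (hK : IsAttractor f K) (hcurve : ¬ ∃ M : Set ℂ, IsAnalyticCurve M ∧ K ⊆ M) :
    ∃ δ : ℝ, 0 < δ ∧ ∀ (w : List (Fin n)) (e : ℂ), ∃ x ∈ K, ∃ y ∈ K,
      δ * ‖e‖ * ‖Complex.exp (wlog f L w 0)‖ ≤ |(e * (wcomp f w x - wcomp f w y)).re| := by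
  by_contra! hcon
  have hstep : ∀ k : ℕ, ∃ (w : List (Fin n)) (e : ℂ), e ≠ 0 ∧ ∀ x ∈ K, ∀ y ∈ K,
      |(e * (wcomp f w x - wcomp f w y)).re| ≤
        1 / ((k : ℝ) + 1) * ‖e‖ * ‖Complex.exp (wlog f L w 0)‖ := by
    intro k
    obtain ⟨w, e, hwe⟩ := hcon (1 / ((k : ℝ) + 1)) (by positivity)
    refine ⟨w, e, ?_, fun x hx y hy => (hwe x hx y hy).le⟩
    rintro rfl
    obtain ⟨x, hx⟩ := hK.nonempty
    have := hwe x hx x hx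
    simp at this
  choose w e he hwe using hstep
  set U : Set ℂ := ball 0 (1 + ε)
  have h0U : (0 : ℂ) ∈ U := h.closedDisc_subset zero_mem_closedDisc
  have hKU : K ⊆ U := hK.subset.trans h.closedDisc_subset
  set s : ℕ → ℂ := fun k => e k / ((‖e k‖ * ‖Complex.exp (wlog f L (w k) 0)‖ : ℝ) : ℂ) with hs
  have hexp0 : ∀ k, 0 < ‖Complex.exp (wlog f L (w k) 0)‖ := fun k =>
    norm_pos_iff.mpr (Complex.exp_ne_zero _)
  have he0 : ∀ k, 0 < ‖e k‖ := fun k => norm_pos_iff.mpr (he k)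
  have hsn : ∀ k, ‖s k‖ * ‖Complex.exp (wlog f L (w k) 0)‖ = 1 := by
    intro k
    have := hexp0 k
    have := he0 k
    simp only [hs, norm_div, Complex.norm_real, norm_mul, norm_norm]
    field_simp
  set F : ℕ → ℂ → ℂ := fun k z => s k * (wcomp f (w k) z - wcomp f (w k) 0) with hF
  set D := B / (1 - r) * (1 + ε) with hD
  have hder : ∀ k, ∀ z ∈ U, HasDerivAt (F k) (s k * Complex.exp (wlog f L (w k) z)) z :=
    fun k z hz => ((h.hasDerivAt_wcomp (w k) hz).sub_const _).const_mul _
  have hdist : ∀ k, ∀ z ∈ U, |(wlog f L (w k) z).re - (wlog f L (w k) 0).re| ≤ D := by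
    intro k z hz
    have h1 := h.norm_wlog_sub_le (w k) hz h0U
    rw [← Complex.sub_re]
    refine (Complex.abs_re_le_norm _).trans (h1.trans ?_)
    refine mul_le_mul_of_nonneg_left ?_ h.distortion_nonneg
    rw [sub_zero]
    exact (mem_ball_zero_iff.mp hz).le
  have hnorm : ∀ k, ∀ z ∈ U, ‖s k * Complex.exp (wlog f L (w k) z)‖ =
      Real.exp ((wlog f L (w k) z).re - (wlog f L (w k) 0).re) := by
    intro k z _
    have h1 := hsn k
    rw [Complex.norm_exp] at h1
    rw [norm_mul, Complex.norm_exp, Real.exp_sub, eq_div_iff (Real.exp_pos _).ne']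
    calc _ = ‖s k‖ * Real.exp (wlog f L (w k) 0).re * Real.exp (wlog f L (w k) z).re := by ring
      _ = _ := by rw [h1, one_mul]
  have hup : ∀ k, ∀ z ∈ U, ‖s k * Complex.exp (wlog f L (w k) z)‖ ≤ Real.exp D := by
    intro k z hz
    rw [hnorm k z hz]
    exact Real.exp_le_exp.mpr (le_of_abs_le (hdist k z hz))
  have hlow : ∀ k, ∀ z ∈ U, Real.exp (-D) ≤ ‖s k * Complex.exp (wlog f L (w k) z)‖ := by
    intro k z hz
    rw [hnorm k z hz]
    exact Real.exp_le_exp.mpr (neg_le_of_abs_le (hdist k z hz))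
  have hlip : ∀ k, ∀ x ∈ U, ∀ y ∈ U, ‖F k x - F k y‖ ≤ Real.exp D * ‖x - y‖ :=
    fun k x hx y hy => (convex_ball (0 : ℂ) (1 + ε)).norm_image_sub_le_of_norm_hasDerivWithin_le
      (fun z hz => (hder k z hz).hasDerivWithinAt) (fun z hz => hup k z hz) hy hx
  have hbdd : ∀ k, ∀ z ∈ U, F k z ∈ closedBall (0 : ℂ) (Real.exp D * (1 + ε)) := by
    intro k z hz
    have h1 := hlip k z hz 0 h0U
    have h2 : F k 0 = 0 := by simp [hF]
    rw [h2, sub_zero, sub_zero] at h1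
    rw [mem_closedBall_zero_iff]
    exact h1.trans (mul_le_mul_of_nonneg_left (mem_ball_zero_iff.mp hz).le (Real.exp_pos _).le)
  -- the limit along a nonprincipal ultrafilter
  let 𝒰 : Ultrafilter ℕ := hyperfilter ℕ
  have hlim : ∀ z, ∃ g : ℂ, z ∈ U → Tendsto (fun k => F k z) 𝒰 (𝓝 g) := by
    intro z
    by_cases hz : z ∈ U
    · obtain ⟨g, -, hg⟩ := (isCompact_closedBall (0 : ℂ)
        (Real.exp D * (1 + ε))).ultrafilter_le_nhds (𝒰.map fun k => F k z)
        (le_principal_iff.mpr (Filter.mem_map.mpr (univ_mem' fun k => hbdd k z hz)))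
      exact ⟨g, fun _ => hg⟩
    · exact ⟨0, fun hz' => absurd hz' hz⟩
  choose G hG using hlim
  have hloc : TendstoLocallyUniformlyOn F G 𝒰 U :=
    tendstoLocallyUniformlyOn_of_lipschitz (Real.exp_pos D) hlip hG
  have hFd : ∀ᶠ k in (𝒰 : Filter ℕ), DifferentiableOn ℂ (F k) U :=
    Eventually.of_forall fun k z hz => (hder k z hz).differentiableAt.differentiableWithinAt
  have hGd : DifferentiableOn ℂ G U := hloc.differentiableOn hFd isOpen_ball
  have hG' : ∀ z ∈ U, deriv G z ≠ 0 := by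
    intro z hz h0
    have h1 := ((hloc.deriv hFd isOpen_ball).tendsto_at hz).norm
    have h2 : Real.exp (-D) ≤ ‖deriv G z‖ := by
      refine ge_of_tendsto h1 (Eventually.of_forall fun k => ?_)
      simp only [Function.comp_apply, (hder k z hz).deriv]
      exact hlow k z hz
    rw [h0, norm_zero] at h2
    exact absurd h2 (not_le.mpr (Real.exp_pos _))
  obtain ⟨x₀, hx₀⟩ := hK.nonempty
  refine hcurve ⟨_, isAnalyticCurve_re_eq_zero (G := fun z => G z - G x₀) isOpen_ball
    (hGd.sub_const _) (fun z hz => by simpa using hG' z hz), fun x hx => ⟨hKU hx, ?_⟩⟩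
  have h1 : Tendsto (fun k => |(F k x - F k x₀).re|) 𝒰 (𝓝 |(G x - G x₀).re|) :=
    ((Complex.continuous_re.tendsto _).comp
      ((hG x (hKU hx)).sub (hG x₀ (hKU hx₀)))).abs
  have h2 : Tendsto (fun k : ℕ => 1 / ((k : ℝ) + 1)) 𝒰 (𝓝 0) :=
    tendsto_one_div_add_atTop_nhds_zero_nat.mono_left Nat.hyperfilter_le_atTop
  have h3 : |(G x - G x₀).re| ≤ 0 := by
    refine le_of_tendsto_of_tendsto' h1 h2 fun k => ?_
    have h4 := hwe k x hx x₀ hx₀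
    set q := ‖e k‖ * ‖Complex.exp (wlog f L (w k) 0)‖ with hq
    have hq0 : 0 < q := mul_pos (he0 k) (hexp0 k)
    have h5 : F k x - F k x₀ =
        ((q⁻¹ : ℝ) : ℂ) * (e k * (wcomp f (w k) x - wcomp f (w k) x₀)) := by
      simp only [hF, hs, ← hq]
      push_cast
      field_simp
      ring
    rw [h5, Complex.re_ofReal_mul, abs_mul, abs_of_pos (inv_pos.mpr hq0), inv_mul_le_iff₀ hq0]
    calc _ ≤ _ := h4
      _ = _ := by rw [hq]; ring
  exact abs_eq_zero.mp (le_antisymm h3 (abs_nonneg _))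

/-! ### The averaging operator and the iterates of the transfer operator -/

/-- The Markov operator `F ↦ ∑ₐ pₐ F ∘ f_a` on real functions. -/
noncomputable def avg (f : Fin n → ℂ → ℂ) (p : Fin n → ℝ) (F : ℂ → ℝ) : ℂ → ℝ :=
  fun x => ∑ a, p a * F (f a x)

/-- The probability of a word. -/
noncomputable def wprob (p : Fin n → ℝ) {N : ℕ} (w : Fin N → Fin n) : ℝ := ∏ i, p (w i)

lemma wprob_pos (hp : ∀ i, 0 < p i) {N : ℕ} (w : Fin N → Fin n) : 0 < wprob p w :=
  Finset.prod_pos fun _ _ => hp _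

lemma sum_wprob_succ {M : Type*} [AddCommMonoid M] {N : ℕ} (F : (Fin (N + 1) → Fin n) → M) :
    ∑ w, F w = ∑ a, ∑ w : Fin N → Fin n, F (Fin.cons a w) := by
  rw [← (Fin.consEquiv fun _ => Fin n).sum_comp, Fintype.sum_prod_type]
  rfl

lemma wprob_cons {N : ℕ} (a : Fin n) (w : Fin N → Fin n) :
    wprob p (Fin.cons a w : Fin (N + 1) → Fin n) = p a * wprob p w := by
  simp [wprob, Fin.prod_univ_succ]

lemma ofFn_cons {N : ℕ} (a : Fin n) (w : Fin N → Fin n) :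
    List.ofFn (Fin.cons a w : Fin (N + 1) → Fin n) = a :: List.ofFn w := by
  simp [List.ofFn_succ]

lemma avg_iterate_eq (N : ℕ) (F : ℂ → ℝ) (x : ℂ) :
    (avg f p)^[N] F x = ∑ w : Fin N → Fin n, wprob p w * F (wcomp f (List.ofFn w) x) := by
  induction N generalizing x with
  | zero => simp [wprob, wcomp]
  | succ N ih =>
    rw [Function.iterate_succ_apply', sum_wprob_succ]
    simp only [avg, ih, Finset.mul_sum, wprob_cons, ofFn_cons, wcomp, mul_assoc]

lemma sum_wprob (hp1 : ∑ i, p i = 1) (N : ℕ) : ∑ w : Fin N → Fin n, wprob p w = 1 := by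
  induction N with
  | zero => simp [wprob]
  | succ N ih =>
    rw [sum_wprob_succ]
    simp only [wprob_cons, ← Finset.mul_sum, ih, mul_one, hp1]

lemma avg_iterate_mono (h : IsLogIFS f L ε r B c) (hp : ∀ i, 0 < p i) (N : ℕ) {F G : ℂ → ℝ}
    (hFG : ∀ x ∈ closedDisc, F x ≤ G x) {x : ℂ} (hx : x ∈ closedDisc) :
    (avg f p)^[N] F x ≤ (avg f p)^[N] G x := by
  rw [avg_iterate_eq, avg_iterate_eq]
  exact Finset.sum_le_sum fun w _ =>
    mul_le_mul_of_nonneg_left (hFG _ (h.mapsD_wcomp _ hx)) (wprob_pos hp w).le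

lemma avg_iterate_const (hp1 : ∑ i, p i = 1) (N : ℕ) (k : ℝ) (x : ℂ) :
    (avg f p)^[N] (fun _ => k) x = k := by
  rw [avg_iterate_eq, ← Finset.sum_mul, sum_wprob hp1, one_mul]

lemma avg_iterate_const_mul (N : ℕ) (k : ℝ) (F : ℂ → ℝ) (x : ℂ) :
    (avg f p)^[N] (fun y => k * F y) x = k * (avg f p)^[N] F x := by
  simp only [avg_iterate_eq, Finset.mul_sum]
  exact Finset.sum_congr rfl fun w _ => by ring

lemma avg_iterate_sub (N : ℕ) (F G : ℂ → ℝ) (x : ℂ) :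
    (avg f p)^[N] (fun y => F y - G y) x = (avg f p)^[N] F x - (avg f p)^[N] G x := by
  simp only [avg_iterate_eq, mul_sub, Finset.sum_sub_distrib]

/-- Cauchy–Schwarz for a weighted sum. -/
lemma sq_sum_mul_le {ι : Type*} (s : Finset ι) (q A H : ι → ℝ) (hq : ∀ i ∈ s, 0 ≤ q i) :
    (∑ i ∈ s, q i * (A i * H i)) ^ 2 ≤ (∑ i ∈ s, q i * A i ^ 2) * ∑ i ∈ s, q i * H i ^ 2 := by
  refine Finset.sum_sq_le_sum_mul_sum_of_sq_le_mul s
    (fun i hi => mul_nonneg (hq i hi) (sq_nonneg _)) (fun i hi => mul_nonneg (hq i hi) (sq_nonneg _))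
    fun i _ => le_of_eq (by ring)

lemma sq_avg_iterate_le (hp : ∀ i, 0 < p i) (hp1 : ∑ i, p i = 1) (N : ℕ) (H : ℂ → ℝ) (x : ℂ) :
    ((avg f p)^[N] H x) ^ 2 ≤ (avg f p)^[N] (fun y => H y ^ 2) x := by
  rw [avg_iterate_eq, avg_iterate_eq]
  have h1 := sq_sum_mul_le Finset.univ (fun w : Fin N → Fin n => wprob p w) (fun _ => 1)
    (fun w => H (wcomp f (List.ofFn w) x)) (fun w _ => (wprob_pos hp w).le)
  simpa [sum_wprob hp1] using h1

/-- The logarithm of the multiplier of the transfer operator, as a real-linear function of a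
logarithm `z` of the derivative. -/
noncomputable def twist (s : ℂ) (ℓ : ℤ) (z : ℂ) : ℂ :=
  -(2 * (Real.pi : ℂ) * s * (z.re : ℂ)) + Complex.I * (ℓ : ℂ) * (z.im : ℂ)

lemma twist_add (s : ℂ) (ℓ : ℤ) (z w : ℂ) : twist s ℓ (z + w) = twist s ℓ z + twist s ℓ w := by
  simp only [twist, Complex.add_re, Complex.add_im]; push_cast; ring

lemma twist_sub (s : ℂ) (ℓ : ℤ) (z w : ℂ) : twist s ℓ (z - w) = twist s ℓ z - twist s ℓ w := by
  simp only [twist, Complex.sub_re, Complex.sub_im]; push_cast; ring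

lemma exp_I_mul_arg_exp (z : ℂ) :
    Complex.exp (Complex.I * (Complex.arg (Complex.exp z) : ℂ)) =
      Complex.exp (Complex.I * (z.im : ℂ)) := by
  have h1 := Complex.norm_mul_exp_arg_mul_I (Complex.exp z)
  have h2 : Complex.exp z = ‖Complex.exp z‖ * Complex.exp (Complex.I * z.im) := by
    rw [Complex.norm_exp, Complex.ofReal_exp, ← Complex.exp_add]
    congr 1
    rw [mul_comm]
    exact (Complex.re_add_im z).symm
  have h3 : ((‖Complex.exp z‖ : ℝ) : ℂ) ≠ 0 := by
    exact_mod_cast (norm_pos_iff.mpr (Complex.exp_ne_zero z)).ne'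
  apply mul_left_cancel₀ h3
  rw [← h2, mul_comm Complex.I, h1]

lemma IsLogIFS.transfer_eq (h : IsLogIFS f L ε r B c) (s : ℂ) (ℓ : ℤ) (g : ℂ → ℂ) {x : ℂ}
    (hx : x ∈ ball (0 : ℂ) (1 + ε)) :
    transfer f p s ℓ g x = ∑ a, (p a : ℂ) * (Complex.exp (twist s ℓ (L a x)) * g (f a x)) := by
  refine Finset.sum_congr rfl fun a _ => ?_
  rw [normCocycle, angleCocycle, h.deriv_eq a x hx, exp_I_mul_arg_exp, Complex.norm_exp,
    Real.log_exp, ← Complex.exp_int_mul, ← Complex.exp_add]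
  have e : 2 * (Real.pi : ℂ) * s * ((-(L a x).re : ℝ) : ℂ) + ℓ * (Complex.I * (L a x).im) =
      twist s ℓ (L a x) := by
    simp only [twist]
    push_cast
    ring
  rw [e]

lemma IsLogIFS.transfer_iterate_eq (h : IsLogIFS f L ε r B c) (s : ℂ) (ℓ : ℤ) (g : ℂ → ℂ)
    (N : ℕ) {x : ℂ} (hx : x ∈ ball (0 : ℂ) (1 + ε)) :
    (transfer f p s ℓ)^[N] g x = ∑ w : Fin N → Fin n, (wprob p w : ℂ) *
      (Complex.exp (twist s ℓ (wlog f L (List.ofFn w) x)) * g (wcomp f (List.ofFn w) x)) := by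
  induction N generalizing x with
  | zero => simp [wprob, wcomp, wlog, twist]
  | succ N ih =>
    rw [Function.iterate_succ_apply', sum_wprob_succ, h.transfer_eq s ℓ _ hx]
    refine Finset.sum_congr rfl fun a _ => ?_
    rw [ih (h.mapsU a hx), Finset.mul_sum, Finset.mul_sum]
    refine Finset.sum_congr rfl fun w _ => ?_
    rw [wprob_cons, ofFn_cons, wlog, wcomp, twist_add, Complex.exp_add]
    push_cast
    ring

/-! ### Bounds for the multiplier -/

lemma twist_re (a b : ℝ) (ℓ : ℤ) (z : ℂ) :
    (twist ((a : ℂ) + (b : ℂ) * Complex.I) ℓ z).re = -(2 * Real.pi * a * z.re) := by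
  simp [twist]

lemma twist_im (a b : ℝ) (ℓ : ℤ) (z : ℂ) :
    (twist ((a : ℂ) + (b : ℂ) * Complex.I) ℓ z).im =
      ((⟨-(2 * Real.pi * b), -(ℓ : ℝ)⟩ : ℂ) * z).re := by
  simp [twist]

lemma norm_twist_le {a b : ℝ} {ℓ : ℤ} (ha : |a| ≤ 1 / 10) (hT : 1 ≤ |b| + |(ℓ : ℝ)|) (z : ℂ) :
    ‖twist ((a : ℂ) + (b : ℂ) * Complex.I) ℓ z‖ ≤ 8 * (|b| + |(ℓ : ℝ)|) * ‖z‖ := by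
  have hpi := Real.pi_lt_d2
  have hpi0 := Real.pi_pos
  have h1 : ‖(a : ℂ) + (b : ℂ) * Complex.I‖ ≤ |a| + |b| := by
    refine (norm_add_le _ _).trans (le_of_eq ?_)
    simp
  have h2 : ‖twist ((a : ℂ) + (b : ℂ) * Complex.I) ℓ z‖ ≤
      2 * Real.pi * ‖(a : ℂ) + (b : ℂ) * Complex.I‖ * |z.re| + |(ℓ : ℝ)| * |z.im| := by
    rw [twist]
    refine (norm_add_le _ _).trans (le_of_eq ?_)
    simp [abs_of_pos hpi0]
  have h3 := Complex.abs_re_le_norm z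
  have h4 := Complex.abs_im_le_norm z
  have h5 : 2 * Real.pi * ‖(a : ℂ) + (b : ℂ) * Complex.I‖ ≤ 6.3 * (1 / 10 + |b|) := by
    have : ‖(a : ℂ) + (b : ℂ) * Complex.I‖ ≤ 1 / 10 + |b| := by linarith
    have h6 : 0 ≤ |b| := abs_nonneg _
    calc _ ≤ 2 * Real.pi * (1 / 10 + |b|) := by gcongr
      _ ≤ _ := by nlinarith
  have h7 : 2 * Real.pi * ‖(a : ℂ) + (b : ℂ) * Complex.I‖ * |z.re| ≤
      6.3 * (1 / 10 + |b|) * ‖z‖ :=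
    mul_le_mul h5 h3 (abs_nonneg _) (by positivity)
  have h8 : |(ℓ : ℝ)| * |z.im| ≤ |(ℓ : ℝ)| * ‖z‖ := by gcongr
  have h9 : 6.3 * (1 / 10 + |b|) + |(ℓ : ℝ)| ≤ 8 * (|b| + |(ℓ : ℝ)|) := by
    have := abs_nonneg b
    have := abs_nonneg (ℓ : ℝ)
    linarith
  nlinarith [norm_nonneg z]

lemma le_norm_frequency (b : ℝ) (ℓ : ℤ) :
    (|b| + |(ℓ : ℝ)|) / 2 ≤ ‖(⟨-(2 * Real.pi * b), -(ℓ : ℝ)⟩ : ℂ)‖ := by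
  have h1 := Complex.abs_re_le_norm (⟨-(2 * Real.pi * b), -(ℓ : ℝ)⟩ : ℂ)
  have h2 := Complex.abs_im_le_norm (⟨-(2 * Real.pi * b), -(ℓ : ℝ)⟩ : ℂ)
  simp only [abs_neg, abs_mul, abs_of_pos Real.pi_pos] at h1 h2
  have h3 : |b| ≤ |2| * Real.pi * |b| := by
    have := Real.pi_gt_three
    rw [abs_of_pos (by norm_num : (0 : ℝ) < 2)]
    nlinarith [abs_nonneg b]
  linarith

lemma norm_frequency_le (b : ℝ) (ℓ : ℤ) :
    ‖(⟨-(2 * Real.pi * b), -(ℓ : ℝ)⟩ : ℂ)‖ ≤ 8 * (|b| + |(ℓ : ℝ)|) := by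
  have h1 := Complex.norm_le_abs_re_add_abs_im (⟨-(2 * Real.pi * b), -(ℓ : ℝ)⟩ : ℂ)
  simp only [abs_neg, abs_mul, abs_of_pos Real.pi_pos, abs_two] at h1
  have := Real.pi_lt_d2
  nlinarith [abs_nonneg b, abs_nonneg (ℓ : ℝ)]

lemma norm_exp_sub_exp_le {z w : ℂ} (hz : z.re ≤ 0) (hw : w.re ≤ 0) :
    ‖Complex.exp z - Complex.exp w‖ ≤ ‖z - w‖ := by
  have := (convex_halfSpace_re_le (0 : ℝ)).norm_image_sub_le_of_norm_hasDerivWithin_le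
    (f := Complex.exp) (f' := Complex.exp) (C := 1)
    (fun x _ => (Complex.hasDerivAt_exp x).hasDerivWithinAt)
    (fun x hx => by rw [Complex.norm_exp]; exact Real.exp_le_one_iff.mpr hx) hw hz
  simpa using this

/-! ### Dominated pairs -/

/-- `H` is a majorant of `u` on `D`, with `log H` Lipschitz with constant `σ` and with increments of
`u` controlled by `H`. This is the invariant of the Dolgopyat iteration; the
exponential form of the Lipschitz bounds makes it stable under sums and products. -/
structure Dominated (u : ℂ → ℂ) (H : ℂ → ℝ) (σ : ℝ) : Prop where
  nonneg : ∀ x ∈ closedDisc, 0 ≤ H x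
  le : ∀ x ∈ closedDisc, ‖u x‖ ≤ H x
  log_lip : ∀ x ∈ closedDisc, ∀ y ∈ closedDisc, H x ≤ Real.exp (σ * ‖x - y‖) * H y
  lip : ∀ x ∈ closedDisc, ∀ y ∈ closedDisc,
    ‖u x - u y‖ ≤ (Real.exp (σ * ‖x - y‖) - 1) * H y

namespace Dominated

lemma mono {u : ℂ → ℂ} {H : ℂ → ℝ} {σ σ' : ℝ} (h : Dominated u H σ) (hσ : σ ≤ σ') :
    Dominated u H σ' where
  nonneg := h.nonneg
  le := h.le
  log_lip x hx y hy := (h.log_lip x hx y hy).trans (by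
    have := h.nonneg y hy
    gcongr)
  lip x hx y hy := (h.lip x hx y hy).trans (by
    have := h.nonneg y hy
    gcongr)

lemma add {u v : ℂ → ℂ} {H G : ℂ → ℝ} {σ : ℝ} (hu : Dominated u H σ) (hv : Dominated v G σ) :
    Dominated (fun x => u x + v x) (fun x => H x + G x) σ where
  nonneg x hx := add_nonneg (hu.nonneg x hx) (hv.nonneg x hx)
  le x hx := (norm_add_le _ _).trans (add_le_add (hu.le x hx) (hv.le x hx))
  log_lip x hx y hy := by
    rw [mul_add]
    exact add_le_add (hu.log_lip x hx y hy) (hv.log_lip x hx y hy)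
  lip x hx y hy := by
    rw [mul_add, add_sub_add_comm]
    exact (norm_add_le _ _).trans (add_le_add (hu.lip x hx y hy) (hv.lip x hx y hy))

lemma const_mul {u : ℂ → ℂ} {H : ℂ → ℝ} {σ : ℝ} (hu : Dominated u H σ) {q : ℝ} (hq : 0 ≤ q) :
    Dominated (fun x => (q : ℂ) * u x) (fun x => q * H x) σ where
  nonneg x hx := mul_nonneg hq (hu.nonneg x hx)
  le x hx := by
    rw [norm_mul, Complex.norm_real, Real.norm_of_nonneg hq]
    exact mul_le_mul_of_nonneg_left (hu.le x hx) hq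
  log_lip x hx y hy := by
    rw [mul_left_comm]
    exact mul_le_mul_of_nonneg_left (hu.log_lip x hx y hy) hq
  lip x hx y hy := by
    rw [← mul_sub, norm_mul, Complex.norm_real, Real.norm_of_nonneg hq, mul_left_comm]
    exact mul_le_mul_of_nonneg_left (hu.lip x hx y hy) hq

lemma sum {ι : Type*} (s : Finset ι) {u : ι → ℂ → ℂ} {H : ι → ℂ → ℝ} {σ : ℝ}
    (h : ∀ i ∈ s, Dominated (u i) (H i) σ) :
    Dominated (fun x => ∑ i ∈ s, u i x) (fun x => ∑ i ∈ s, H i x) σ := by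
  classical
  induction s using Finset.induction_on with
  | empty =>
    exact ⟨by simp, by simp, by simp, by simp⟩
  | insert a s ha ih =>
    simp only [Finset.sum_insert ha]
    exact (h a (Finset.mem_insert_self _ _)).add
      (ih fun i hi => h i (Finset.mem_insert_of_mem hi))

end Dominated

/-- One branch of the (normalized) iterated transfer operator: the multiplier of the word `w`, times
`e^{-k}`, times the composition with the word. -/
noncomputable def branch (f L : Fin n → ℂ → ℂ) (s : ℂ) (ℓ : ℤ) (k : ℝ) (w : List (Fin n))
    (u : ℂ → ℂ) : ℂ → ℂ :=
  fun x => Complex.exp (twist s ℓ (wlog f L w x) - k) * u (wcomp f w x)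

lemma exp_mul_sub_one_add_le {α β : ℝ} (hα : 0 ≤ α) (hβ : 0 ≤ β) :
    (Real.exp α - 1) + (Real.exp β - 1) ≤ Real.exp (α + β) - 1 := by
  rw [Real.exp_add]
  nlinarith [Real.one_le_exp hα, Real.one_le_exp hβ]

/-- After normalization by `e^{-k}` the multiplier of a word has modulus at most `1`. -/
lemma IsLogIFS.twist_re_le (h : IsLogIFS f L ε r B c) {a b k : ℝ} {ℓ : ℤ} (w : List (Fin n))
    (hk : 2 * Real.pi * |a| * (c * w.length) ≤ k) {x : ℂ} (hx : x ∈ ball (0 : ℂ) (1 + ε)) :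
    (twist ((a : ℂ) + (b : ℂ) * Complex.I) ℓ (wlog f L w x) - k).re ≤ 0 := by
  rw [Complex.sub_re, twist_re, Complex.ofReal_re]
  have h1 := h.wlog_re_nonpos w hx
  have h2 := h.le_wlog_re w hx
  have h3 : -(a * (wlog f L w x).re) ≤ |a| * (c * w.length) := by
    have : |a * (wlog f L w x).re| ≤ |a| * (c * w.length) := by
      rw [abs_mul, abs_of_nonpos h1]
      exact mul_le_mul_of_nonneg_left (by linarith) (abs_nonneg _)
    linarith [neg_abs_le (a * (wlog f L w x).re)]
  nlinarith [Real.pi_pos]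

lemma Dominated.branch (h : IsLogIFS f L ε r B c) {a b k σ : ℝ} {ℓ : ℤ} (ha : |a| ≤ 1 / 10)
    (hT : 1 ≤ |b| + |(ℓ : ℝ)|) (w : List (Fin n)) (hk : 2 * Real.pi * |a| * (c * w.length) ≤ k)
    {u : ℂ → ℂ} {H : ℂ → ℝ} (hσ : 0 ≤ σ) (hu : Dominated u H σ) :
    Dominated (branch f L ((a : ℂ) + (b : ℂ) * Complex.I) ℓ k w u) (fun x => H (wcomp f w x))
      (σ * r ^ w.length + 8 * (|b| + |(ℓ : ℝ)|) * (B / (1 - r))) := by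
  have hΛ := h.distortion_nonneg
  have hU := h.closedDisc_subset
  have hD := h.mapsD_wcomp w
  have hT0 : 0 ≤ |b| + |(ℓ : ℝ)| := by linarith
  have hr0 := pow_nonneg h.r_pos.le w.length
  have hle1 : ∀ x ∈ closedDisc, ‖Complex.exp (twist ((a : ℂ) + (b : ℂ) * Complex.I) ℓ
      (wlog f L w x) - k)‖ ≤ 1 := by
    intro x hx
    rw [Complex.norm_exp]
    exact Real.exp_le_one_iff.mpr (h.twist_re_le w hk (hU hx))
  have hdist : ∀ x ∈ closedDisc, ∀ y ∈ closedDisc, σ * ‖wcomp f w x - wcomp f w y‖ ≤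
      σ * r ^ w.length * ‖x - y‖ := by
    intro x hx y hy
    rw [mul_assoc]
    exact mul_le_mul_of_nonneg_left (h.norm_wcomp_sub_le w (hU hx) (hU hy)) hσ
  refine ⟨fun x hx => hu.nonneg _ (hD hx), fun x hx => ?_, fun x hx y hy => ?_,
    fun x hx y hy => ?_⟩
  · rw [ConformalIFS.branch, norm_mul]
    calc _ ≤ 1 * ‖u (wcomp f w x)‖ := mul_le_mul_of_nonneg_right (hle1 x hx) (norm_nonneg _)
      _ ≤ _ := by rw [one_mul]; exact hu.le _ (hD hx)
  · refine (hu.log_lip _ (hD hx) _ (hD hy)).trans ?_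
    refine mul_le_mul_of_nonneg_right (Real.exp_le_exp.mpr ((hdist x hx y hy).trans ?_))
      (hu.nonneg _ (hD hy))
    rw [add_mul]
    have : 0 ≤ 8 * (|b| + |(ℓ : ℝ)|) * (B / (1 - r)) * ‖x - y‖ := by positivity
    linarith
  · set e : ℂ → ℂ := fun x => Complex.exp (twist ((a : ℂ) + (b : ℂ) * Complex.I) ℓ
      (wlog f L w x) - k) with he
    have h1 : ‖e x - e y‖ ≤ Real.exp (8 * (|b| + |(ℓ : ℝ)|) * (B / (1 - r)) * ‖x - y‖) - 1 := by
      refine (norm_exp_sub_exp_le (h.twist_re_le w hk (hU hx))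
        (h.twist_re_le w hk (hU hy))).trans ?_
      rw [sub_sub_sub_cancel_right, ← twist_sub]
      refine (norm_twist_le ha hT _).trans ?_
      have h2 := h.norm_wlog_sub_le w (hU hx) (hU hy)
      have h3 := Real.add_one_le_exp (8 * (|b| + |(ℓ : ℝ)|) * (B / (1 - r)) * ‖x - y‖)
      have h4 : 8 * (|b| + |(ℓ : ℝ)|) * ‖wlog f L w x - wlog f L w y‖ ≤
          8 * (|b| + |(ℓ : ℝ)|) * (B / (1 - r) * ‖x - y‖) := by gcongr
      linarith
    have h2 : ‖u (wcomp f w x) - u (wcomp f w y)‖ ≤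
        (Real.exp (σ * r ^ w.length * ‖x - y‖) - 1) * H (wcomp f w y) := by
      refine (hu.lip _ (hD hx) _ (hD hy)).trans ?_
      have := hdist x hx y hy
      have h0 := hu.nonneg _ (hD hy)
      gcongr
    have h3 : e x * u (wcomp f w x) - e y * u (wcomp f w y) =
        e x * (u (wcomp f w x) - u (wcomp f w y)) + (e x - e y) * u (wcomp f w y) := by ring
    change ‖e x * u (wcomp f w x) - e y * u (wcomp f w y)‖ ≤ _
    rw [h3]
    have h0 := hu.nonneg _ (hD hy)
    calc _ ≤ ‖e x‖ * ‖u (wcomp f w x) - u (wcomp f w y)‖ + ‖e x - e y‖ * ‖u (wcomp f w y)‖ := by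
          rw [← norm_mul, ← norm_mul]; exact norm_add_le _ _
      _ ≤ 1 * ((Real.exp (σ * r ^ w.length * ‖x - y‖) - 1) * H (wcomp f w y)) +
          (Real.exp (8 * (|b| + |(ℓ : ℝ)|) * (B / (1 - r)) * ‖x - y‖) - 1) *
            H (wcomp f w y) := by
          refine add_le_add (mul_le_mul (hle1 x hx) h2 (norm_nonneg _) zero_le_one)
            (mul_le_mul h1 (hu.le _ (hD hy)) (norm_nonneg _) ((norm_nonneg _).trans h1))
      _ = ((Real.exp (σ * r ^ w.length * ‖x - y‖) - 1) +
          (Real.exp (8 * (|b| + |(ℓ : ℝ)|) * (B / (1 - r)) * ‖x - y‖) - 1)) *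
            H (wcomp f w y) := by ring
      _ ≤ _ := by
          refine mul_le_mul_of_nonneg_right ?_ h0
          rw [add_mul]
          exact exp_mul_sub_one_add_le (by positivity) (by positivity)

lemma IsLogIFS.transfer_iterate_eq_branch (h : IsLogIFS f L ε r B c) (s : ℂ) (ℓ : ℤ) (k : ℝ)
    (g : ℂ → ℂ) (N : ℕ) {x : ℂ} (hx : x ∈ ball (0 : ℂ) (1 + ε)) :
    (Real.exp (-k) : ℂ) * (transfer f p s ℓ)^[N] g x = ∑ w : Fin N → Fin n,
      (wprob p w : ℂ) * branch f L s ℓ k (List.ofFn w) g x := by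
  rw [h.transfer_iterate_eq s ℓ g N hx, Finset.mul_sum]
  refine Finset.sum_congr rfl fun w _ => ?_
  rw [branch, sub_eq_add_neg, Complex.exp_add]
  push_cast
  ring

lemma Dominated.congr {u v : ℂ → ℂ} {H : ℂ → ℝ} {σ : ℝ} (hu : Dominated u H σ)
    (huv : ∀ x ∈ closedDisc, v x = u x) : Dominated v H σ where
  nonneg := hu.nonneg
  le x hx := by rw [huv x hx]; exact hu.le x hx
  log_lip := hu.log_lip
  lip x hx y hy := by rw [huv x hx, huv y hy]; exact hu.lip x hx y hy

/-- The trivial domination of the iterates, with no gain. -/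
lemma Dominated.transfer_iterate (h : IsLogIFS f L ε r B c) (hp : ∀ i, 0 < p i)
    {a b k σ : ℝ} {ℓ : ℤ} (ha : |a| ≤ 1 / 10)
    (hT : 1 ≤ |b| + |(ℓ : ℝ)|) (N : ℕ) (hk : 2 * Real.pi * |a| * (c * N) ≤ k)
    {u : ℂ → ℂ} {H : ℂ → ℝ} (hσ : 0 ≤ σ) (hu : Dominated u H σ) :
    Dominated (fun x => (Real.exp (-k) : ℂ) *
        (transfer f p ((a : ℂ) + (b : ℂ) * Complex.I) ℓ)^[N] u x)
      ((avg f p)^[N] H) (σ * r ^ N + 8 * (|b| + |(ℓ : ℝ)|) * (B / (1 - r))) := by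
  have hr0 := pow_nonneg h.r_pos.le N
  have hΛ := h.distortion_nonneg
  have h1 := Dominated.sum (Finset.univ : Finset (Fin N → Fin n))
    (u := fun w x => (wprob p w : ℂ) *
      ConformalIFS.branch f L ((a : ℂ) + (b : ℂ) * Complex.I) ℓ k (List.ofFn w) u x)
    (H := fun w x => wprob p w * H (wcomp f (List.ofFn w) x))
    (σ := σ * r ^ N + 8 * (|b| + |(ℓ : ℝ)|) * (B / (1 - r)))
    (fun w _ => by
      have h2 := hu.branch h ha hT (List.ofFn w) (k := k) (by simpa using hk) hσ
      rw [List.length_ofFn] at h2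
      exact h2.const_mul (wprob_pos hp w).le)
  have h3 : (avg f p)^[N] H = fun x => ∑ w : Fin N → Fin n, wprob p w *
      H (wcomp f (List.ofFn w) x) := funext fun x => avg_iterate_eq N H x
  rw [h3]
  exact h1.congr fun x hx =>
    h.transfer_iterate_eq_branch _ _ _ _ _ (h.closedDisc_subset hx)

/-! ### Two cancelling branches -/

/-- The majorant of a sum `v₁ + v₂` of two branches with majorants `X`, `Y`: the
modulus of the sum itself where there is no cancellation, and a definite proportion `η` of the
smaller majorant less than `X + Y` where there is. -/
noncomputable def pairMajorant (η : ℝ) (v₁ v₂ : ℂ → ℂ) (X Y : ℂ → ℝ) : ℂ → ℝ :=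
  fun x => max ‖v₁ x + v₂ x‖ (X x + Y x - η * min (X x) (Y x))

lemma add_sub_mul_min_eq_max {η X Y : ℝ} (hη : 0 ≤ η) :
    X + Y - η * min X Y = max ((1 - η) * X + Y) (X + (1 - η) * Y) := by
  rcases le_total X Y with h | h
  · rw [min_eq_left h, max_eq_left (by nlinarith)]; ring
  · rw [min_eq_right h, max_eq_right (by nlinarith)]; ring

section pair

variable {v₁ v₂ : ℂ → ℂ} {X Y : ℂ → ℝ} {σ η : ℝ}

lemma pairMajorant_le (h₁ : Dominated v₁ X σ) (h₂ : Dominated v₂ Y σ) (hη : 0 ≤ η) {x : ℂ}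
    (hx : x ∈ closedDisc) : pairMajorant η v₁ v₂ X Y x ≤ X x + Y x := by
  refine max_le ((norm_add_le _ _).trans (add_le_add (h₁.le x hx) (h₂.le x hx))) ?_
  have := mul_nonneg hη (le_min (h₁.nonneg x hx) (h₂.nonneg x hx))
  linarith

lemma le_pairMajorant (h₁ : Dominated v₁ X σ) (h₂ : Dominated v₂ Y σ) (hη1 : η ≤ 1) {x : ℂ}
    (hx : x ∈ closedDisc) : (X x + Y x) / 2 ≤ pairMajorant η v₁ v₂ X Y x := by
  refine le_trans ?_ (le_max_right _ _)
  have h0 := le_min (h₁.nonneg x hx) (h₂.nonneg x hx)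
  have h1 := min_le_left (X x) (Y x)
  have h2 := min_le_right (X x) (Y x)
  nlinarith

lemma Dominated.pair (h₁ : Dominated v₁ X σ) (h₂ : Dominated v₂ Y σ) (hσ : 0 ≤ σ)
    (hη : 0 ≤ η) (hη1 : η ≤ 1) :
    Dominated (fun x => v₁ x + v₂ x) (pairMajorant η v₁ v₂ X Y) (2 * σ) := by
  have hnn : ∀ x ∈ closedDisc, 0 ≤ pairMajorant η v₁ v₂ X Y x := fun x _ =>
    le_max_of_le_left (norm_nonneg _)
  have hlip : ∀ x ∈ closedDisc, ∀ y ∈ closedDisc, ‖v₁ x + v₂ x - (v₁ y + v₂ y)‖ ≤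
      (Real.exp (2 * σ * ‖x - y‖) - 1) * pairMajorant η v₁ v₂ X Y y := by
    intro x hx y hy
    have h1 := (h₁.add h₂).lip x hx y hy
    have h2 := le_pairMajorant h₁ h₂ hη1 hy
    have h3 := exp_mul_sub_one_add_le (α := σ * ‖x - y‖) (β := σ * ‖x - y‖)
      (by positivity) (by positivity)
    have h4 : σ * ‖x - y‖ + σ * ‖x - y‖ = 2 * σ * ‖x - y‖ := by ring
    have h5 : 0 ≤ Real.exp (σ * ‖x - y‖) - 1 := by
      linarith [Real.one_le_exp (by positivity : 0 ≤ σ * ‖x - y‖)]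
    rw [h4] at h3
    have h6 := hnn y hy
    calc _ ≤ (Real.exp (σ * ‖x - y‖) - 1) * (X y + Y y) := h1
      _ ≤ (Real.exp (σ * ‖x - y‖) - 1) * (2 * pairMajorant η v₁ v₂ X Y y) :=
          mul_le_mul_of_nonneg_left (by linarith) h5
      _ ≤ _ := by nlinarith
  refine ⟨hnn, fun x _ => le_max_left _ _, fun x hx y hy => ?_, hlip⟩
  have hM := hnn y hy
  refine max_le ?_ ?_
  · have h1 := hlip x hx y hy
    have h2 := norm_sub_norm_le (v₁ x + v₂ x) (v₁ y + v₂ y)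
    have h3 : ‖v₁ y + v₂ y‖ ≤ pairMajorant η v₁ v₂ X Y y := le_max_left _ _
    linarith
  · rw [add_sub_mul_min_eq_max hη]
    have hE : Real.exp (σ * ‖x - y‖) ≤ Real.exp (2 * σ * ‖x - y‖) := by
      apply Real.exp_le_exp.mpr
      nlinarith [mul_nonneg hσ (norm_nonneg (x - y))]
    have hX := (h₁.log_lip x hx y hy).trans (mul_le_mul_of_nonneg_right hE (h₁.nonneg y hy))
    have hY := (h₂.log_lip x hx y hy).trans (mul_le_mul_of_nonneg_right hE (h₂.nonneg y hy))
    have h1 : max ((1 - η) * X y + Y y) (X y + (1 - η) * Y y) ≤ pairMajorant η v₁ v₂ X Y y := by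
      rw [← add_sub_mul_min_eq_max hη]
      exact le_max_right _ _
    have h2 := (le_max_left _ _).trans h1
    have h3 := (le_max_right _ _).trans h1
    have hE0 := Real.exp_pos (2 * σ * ‖x - y‖)
    have hη' : 0 ≤ 1 - η := by linarith
    refine max_le ?_ ?_
    · calc _ ≤ (1 - η) * (Real.exp (2 * σ * ‖x - y‖) * X y) +
            Real.exp (2 * σ * ‖x - y‖) * Y y :=
            add_le_add (mul_le_mul_of_nonneg_left hX hη') hY
        _ = Real.exp (2 * σ * ‖x - y‖) * ((1 - η) * X y + Y y) := by ring
        _ ≤ _ := mul_le_mul_of_nonneg_left h2 hE0.le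
    · calc _ ≤ Real.exp (2 * σ * ‖x - y‖) * X y +
            (1 - η) * (Real.exp (2 * σ * ‖x - y‖) * Y y) :=
            add_le_add hX (mul_le_mul_of_nonneg_left hY hη')
        _ = Real.exp (2 * σ * ‖x - y‖) * (X y + (1 - η) * Y y) := by ring
        _ ≤ _ := mul_le_mul_of_nonneg_left h3 hE0.le

end pair

/-! ### Alignment of complex numbers whose sum is almost as long as possible -/

lemma norm_div_norm {z : ℂ} (hz : z ≠ 0) : ‖z / (‖z‖ : ℂ)‖ = 1 := by
  rw [norm_div, Complex.norm_real, norm_norm, div_self (norm_ne_zero_iff.mpr hz)]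

lemma norm_add_le_of_unit {e₁ e₂ : ℂ} (h₁ : ‖e₁‖ = 1) (h₂ : ‖e₂‖ = 1) :
    ‖e₁ + e₂‖ ≤ 2 - ‖e₁ - e₂‖ ^ 2 / 4 := by
  have hp := parallelogram_law_with_norm ℝ e₁ e₂
  rw [h₁, h₂] at hp
  have h3 : ‖e₁ - e₂‖ ≤ 2 := (norm_sub_le _ _).trans (by rw [h₁, h₂]; norm_num)
  have h0 := norm_nonneg (e₁ - e₂)
  have h4 : ‖e₁ - e₂‖ ^ 2 ≤ 4 := by nlinarith
  refine abs_le_of_sq_le_sq' ?_ (by linarith) |>.2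
  nlinarith [sq_nonneg (‖e₁ - e₂‖ ^ 2)]

lemma norm_add_le_sub_min {z w : ℂ} (hz : z ≠ 0) (hw : w ≠ 0) :
    ‖z + w‖ ≤ ‖z‖ + ‖w‖ - ‖z / (‖z‖ : ℂ) - w / (‖w‖ : ℂ)‖ ^ 2 / 4 * min ‖z‖ ‖w‖ := by
  wlog h : ‖z‖ ≤ ‖w‖ generalizing z w
  · have := this hw hz (le_of_not_ge h)
    rw [add_comm z w, add_comm ‖z‖, min_comm, norm_sub_rev]
    exact this
  have hz0 : (‖z‖ : ℂ) ≠ 0 := by exact_mod_cast norm_ne_zero_iff.mpr hz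
  have hw0 : (‖w‖ : ℂ) ≠ 0 := by exact_mod_cast norm_ne_zero_iff.mpr hw
  have e : z + w = (‖z‖ : ℂ) * (z / ‖z‖ + w / ‖w‖) + ((‖w‖ - ‖z‖ : ℝ) : ℂ) * (w / ‖w‖) := by
    push_cast
    field_simp
    ring
  rw [min_eq_left h]
  calc ‖z + w‖ ≤ ‖z‖ * ‖z / (‖z‖ : ℂ) + w / (‖w‖ : ℂ)‖ + (‖w‖ - ‖z‖) * 1 := by
        rw [e]
        refine (norm_add_le _ _).trans ?_
        rw [norm_mul, norm_mul, norm_div_norm hw, Complex.norm_real, Complex.norm_real, norm_norm,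
          Real.norm_of_nonneg (by linarith : 0 ≤ ‖w‖ - ‖z‖)]
    _ ≤ ‖z‖ * (2 - ‖z / (‖z‖ : ℂ) - w / (‖w‖ : ℂ)‖ ^ 2 / 4) + (‖w‖ - ‖z‖) * 1 := by
        gcongr
        exact norm_add_le_of_unit (norm_div_norm hz) (norm_div_norm hw)
    _ = _ := by ring

lemma norm_unit_sub_unit_le {z w : ℂ} (hz : z ≠ 0) (hw : w ≠ 0) :
    ‖z / (‖z‖ : ℂ) - w / (‖w‖ : ℂ)‖ ≤ 2 * ‖z - w‖ / ‖w‖ := by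
  have hz0 : (‖z‖ : ℂ) ≠ 0 := by exact_mod_cast norm_ne_zero_iff.mpr hz
  have hw0 : (‖w‖ : ℂ) ≠ 0 := by exact_mod_cast norm_ne_zero_iff.mpr hw
  have hw1 : 0 < ‖w‖ := norm_pos_iff.mpr hw
  have e : z / (‖z‖ : ℂ) - w / (‖w‖ : ℂ) =
      (((‖w‖ - ‖z‖ : ℝ) : ℂ) * (z / ‖z‖) + (z - w)) / ‖w‖ := by
    push_cast
    field_simp
    ring
  rw [e, norm_div, Complex.norm_real, norm_norm]
  gcongr
  refine (norm_add_le _ _).trans ?_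
  rw [norm_mul, norm_div_norm hz, Complex.norm_real, mul_one, Real.norm_eq_abs]
  have := abs_norm_sub_norm_le w z
  rw [norm_sub_rev] at this
  linarith

/-- If a sum fails to gain on the sum of the majorants, then both terms nearly reach their
majorants and they are nearly aligned. -/
lemma aligned_of_lt {z w : ℂ} {X Y η : ℝ} (hX : 0 < X) (hY : 0 < Y) (hη : 0 ≤ η) (hη2 : η ≤ 1 / 2)
    (hz : ‖z‖ ≤ X) (hw : ‖w‖ ≤ Y) (hlt : X + Y - η * min X Y < ‖z + w‖) :
    (1 - η) * X ≤ ‖z‖ ∧ (1 - η) * Y ≤ ‖w‖ ∧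
      ‖z / (‖z‖ : ℂ) - w / (‖w‖ : ℂ)‖ ^ 2 ≤ 8 * η := by
  have h1 := norm_add_le z w
  have h2 := mul_le_mul_of_nonneg_left (min_le_left X Y) hη
  have h3 := mul_le_mul_of_nonneg_left (min_le_right X Y) hη
  have hzX : (1 - η) * X ≤ ‖z‖ := by linarith
  have hwY : (1 - η) * Y ≤ ‖w‖ := by linarith
  refine ⟨hzX, hwY, ?_⟩
  have hz0 : z ≠ 0 := norm_pos_iff.mp (by nlinarith)
  have hw0 : w ≠ 0 := norm_pos_iff.mp (by nlinarith)
  have h4 := norm_add_le_sub_min hz0 hw0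
  have hm : 0 < min X Y := lt_min hX hY
  have h5 : min X Y / 2 ≤ min ‖z‖ ‖w‖ := by
    refine le_min ?_ ?_
    · have := min_le_left X Y
      nlinarith
    · have := min_le_right X Y
      nlinarith
  set q := ‖z / (‖z‖ : ℂ) - w / (‖w‖ : ℂ)‖ ^ 2
  have hq : 0 ≤ q := sq_nonneg _
  have h6 : q / 4 * (min X Y / 2) ≤ q / 4 * min ‖z‖ ‖w‖ := by gcongr
  have h7 : q / 4 * (min X Y / 2) < η * min X Y := by linarith
  by_contra hcon
  push Not at hcon
  nlinarith

lemma unit_exp_mul {q : ℝ} (hq : 0 < q) (ζ u : ℂ) :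
    ((q : ℂ) * (Complex.exp ζ * u)) / (‖(q : ℂ) * (Complex.exp ζ * u)‖ : ℂ) =
      Complex.exp (Complex.I * (ζ.im : ℂ)) * (u / (‖u‖ : ℂ)) := by
  have hq0 : (q : ℂ) ≠ 0 := by exact_mod_cast hq.ne'
  have h1 : Complex.exp ζ = (Real.exp ζ.re : ℂ) * Complex.exp (Complex.I * ζ.im) := by
    rw [Complex.ofReal_exp, ← Complex.exp_add]
    congr 1
    rw [mul_comm]
    exact (Complex.re_add_im ζ).symm
  have h2 : (Real.exp ζ.re : ℂ) ≠ 0 := by exact_mod_cast (Real.exp_pos _).ne'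
  rw [norm_mul, norm_mul, Complex.norm_real, Real.norm_of_nonneg hq.le, Complex.norm_exp]
  conv_lhs => rw [h1]
  push_cast
  rw [← Complex.ofReal_exp]
  by_cases hu : u = 0
  · simp [hu]
  have h3 : (‖u‖ : ℂ) ≠ 0 := by exact_mod_cast norm_ne_zero_iff.mpr hu
  field_simp

lemma norm_exp_I_sub_le (s t : ℝ) :
    ‖Complex.exp (Complex.I * s) - Complex.exp (Complex.I * t)‖ ≤ |s - t| := by
  have h1 : Complex.exp (Complex.I * s) - Complex.exp (Complex.I * t) =
      Complex.exp (Complex.I * t) * (Complex.exp (Complex.I * ((s - t : ℝ) : ℂ)) - 1) := by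
    rw [mul_sub, ← Complex.exp_add, mul_one]
    congr 2
    push_cast
    ring
  rw [h1, norm_mul, Complex.norm_exp_I_mul_ofReal, one_mul]
  exact Real.norm_exp_I_mul_ofReal_sub_one_le

lemma le_norm_exp_I_sub {s t : ℝ} (hst : |s - t| ≤ 1) :
    |s - t| / 2 ≤ ‖Complex.exp (Complex.I * s) - Complex.exp (Complex.I * t)‖ := by
  have h1 : Complex.exp (Complex.I * s) - Complex.exp (Complex.I * t) =
      Complex.exp (Complex.I * t) * (Complex.exp (Complex.I * ((s - t : ℝ) : ℂ)) - 1) := by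
    rw [mul_sub, ← Complex.exp_add, mul_one]
    congr 2
    push_cast
    ring
  rw [h1, norm_mul, Complex.norm_exp_I_mul_ofReal, one_mul, Complex.norm_exp_I_mul_ofReal_sub_one,
    Real.norm_eq_abs, abs_mul, abs_two]
  have h2 : |Real.sin ((s - t) / 2)| = Real.sin (|s - t| / 2) := by
    rcases le_total 0 (s - t) with h | h
    · rw [abs_of_nonneg h, abs_of_nonneg]
      exact Real.sin_nonneg_of_nonneg_of_le_pi (by linarith)
        (by rw [abs_of_nonneg h] at hst; linarith [Real.pi_gt_three])
    · rw [abs_of_nonpos h, neg_div, Real.sin_neg, abs_of_nonpos]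
      exact Real.sin_nonpos_of_nonpos_of_neg_pi_le (by linarith)
        (by rw [abs_of_nonpos h] at hst; linarith [Real.pi_gt_three])
  rw [h2]
  have h3 := Real.mul_le_sin (x := |s - t| / 2) (by positivity) (by linarith [Real.pi_gt_three])
  have h4 : 1 / 2 ≤ 2 / Real.pi := by
    rw [div_le_div_iff₀ (by norm_num) Real.pi_pos]
    linarith [Real.pi_le_four]
  nlinarith [abs_nonneg (s - t)]

/-- Uniform first-order approximation of a holomorphic function on the disc. -/
lemma exists_linearization {F : ℂ → ℂ} {U : Set ℂ} (hU : IsOpen U) (hDU : closedDisc ⊆ U)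
    (hF : DifferentiableOn ℂ F U) {e : ℝ} (he : 0 < e) :
    ∃ d : ℝ, 0 < d ∧ ∀ x ∈ closedDisc, ∀ y ∈ closedDisc, ∀ z ∈ closedDisc, ‖x - z‖ < d →
      ‖y - z‖ < d → ‖F x - F y - deriv F z * (x - y)‖ ≤ e * ‖x - y‖ := by
  have hc : ContinuousOn (deriv F) closedDisc := (hF.deriv hU).continuousOn.mono hDU
  have huc := isCompact_closedDisc.uniformContinuousOn_of_continuous hc
  rw [Metric.uniformContinuousOn_iff] at huc
  obtain ⟨d, hd, hdF⟩ := huc e he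
  refine ⟨d, hd, fun x hx y hy z hz hxz hyz => ?_⟩
  have h1 := (convex_closedDisc.inter (convex_ball z d)).norm_image_sub_le_of_norm_hasDerivWithin_le
    (f := fun t => F t - deriv F z * t) (f' := fun t => deriv F t - deriv F z) (C := e)
    (fun t ht => ?_) (fun t ht => ?_) ⟨hy, by rwa [mem_ball, dist_eq_norm]⟩
    ⟨hx, by rwa [mem_ball, dist_eq_norm]⟩
  · have e1 : F x - F y - deriv F z * (x - y) =
        (F x - deriv F z * x) - (F y - deriv F z * y) := by ring
    rw [e1]
    exact h1
  · have h2 := (hF.differentiableAt (hU.mem_nhds (hDU ht.1))).hasDerivAt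
    simpa using! (h2.sub ((hasDerivAt_id t).const_mul (deriv F z))).hasDerivWithinAt
  · have h2 := hdF t ht.1 z hz ht.2
    rw [dist_eq_norm] at h2
    exact h2.le

/-! ### Cancellation in every cylinder -/

/-- If two products of a phase and a unit complex number are nearly aligned at two
points, and the unit complex numbers vary little, then the phase difference varies little. -/
lemma norm_exp_sub_exp_le_of_aligned {φ₁ φ₂ φ₁' φ₂' : ℝ} {a₁ a₂ a₁' a₂' : ℂ} {e₁ e₂ : ℝ}
    (ha : ‖a₁‖ = 1)
    (h : ‖Complex.exp (Complex.I * φ₁) * a₁ - Complex.exp (Complex.I * φ₂) * a₂‖ ≤ e₁)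
    (h' : ‖Complex.exp (Complex.I * φ₁') * a₁' - Complex.exp (Complex.I * φ₂') * a₂'‖ ≤ e₁)
    (h1 : ‖a₁ - a₁'‖ ≤ e₂) (h2 : ‖a₂ - a₂'‖ ≤ e₂) :
    ‖Complex.exp (Complex.I * ((φ₁ - φ₂ : ℝ) : ℂ)) -
      Complex.exp (Complex.I * ((φ₁' - φ₂' : ℝ) : ℂ))‖ ≤ 2 * e₁ + 2 * e₂ := by
  have key : ∀ {s t : ℝ} {a b : ℂ},
      ‖Complex.exp (Complex.I * s) * a - Complex.exp (Complex.I * t) * b‖ ≤ e₁ →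
      ‖Complex.exp (Complex.I * ((s - t : ℝ) : ℂ)) * a - b‖ ≤ e₁ := by
    intro s t a b hab
    have e : Complex.exp (Complex.I * s) * a - Complex.exp (Complex.I * t) * b =
        Complex.exp (Complex.I * t) *
          (Complex.exp (Complex.I * ((s - t : ℝ) : ℂ)) * a - b) := by
      rw [mul_sub, ← mul_assoc, ← Complex.exp_add]
      congr 3
      push_cast
      ring
    rwa [e, norm_mul, Complex.norm_exp_I_mul_ofReal, one_mul] at hab
  have k1 := key h
  have k2 := key h'
  set E := Complex.exp (Complex.I * ((φ₁ - φ₂ : ℝ) : ℂ))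
  set E' := Complex.exp (Complex.I * ((φ₁' - φ₂' : ℝ) : ℂ)) with hE'
  have hE'1 : ‖E'‖ = 1 := Complex.norm_exp_I_mul_ofReal _
  have e : (E - E') * a₁ = (E * a₁ - a₂) - (E' * a₁' - a₂') + (a₂ - a₂') - E' * (a₁ - a₁') := by
    ring
  calc ‖E - E'‖ = ‖(E - E') * a₁‖ := by rw [norm_mul, ha, mul_one]
    _ ≤ ‖E * a₁ - a₂‖ + ‖E' * a₁' - a₂'‖ + ‖a₂ - a₂'‖ + ‖E' * (a₁ - a₁')‖ := by
        rw [e]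
        refine (norm_sub_le _ _).trans (add_le_add ((norm_add_le _ _).trans
          (add_le_add (norm_sub_le _ _) le_rfl)) le_rfl)
    _ ≤ e₁ + e₁ + e₂ + e₂ := by
        rw [norm_mul, hE'1, one_mul]
        gcongr
    _ = _ := by ring

lemma IsLogIFS.norm_twist_wlog_sub_im_le (h : IsLogIFS f L ε r B c) {b : ℝ} {ℓ : ℤ}
    (w₁ w₂ : List (Fin n)) {x y : ℂ} (hx : x ∈ closedDisc) (hy : y ∈ closedDisc) :
    |((⟨-(2 * Real.pi * b), -(ℓ : ℝ)⟩ : ℂ) * (wlog f L w₁ x - wlog f L w₂ x)).re -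
      ((⟨-(2 * Real.pi * b), -(ℓ : ℝ)⟩ : ℂ) * (wlog f L w₁ y - wlog f L w₂ y)).re| ≤
      16 * (|b| + |(ℓ : ℝ)|) * (B / (1 - r)) * ‖x - y‖ := by
  have h1 := h.norm_wlog_sub_le w₁ (h.closedDisc_subset hx) (h.closedDisc_subset hy)
  have h2 := h.norm_wlog_sub_le w₂ (h.closedDisc_subset hx) (h.closedDisc_subset hy)
  rw [← Complex.sub_re, ← mul_sub]
  refine (Complex.abs_re_le_norm _).trans ?_
  rw [norm_mul]
  have h3 : ‖wlog f L w₁ x - wlog f L w₂ x - (wlog f L w₁ y - wlog f L w₂ y)‖ ≤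
      2 * (B / (1 - r) * ‖x - y‖) := by
    rw [sub_sub_sub_comm]
    refine (norm_sub_le _ _).trans ?_
    linarith
  have h4 := norm_frequency_le b ℓ
  calc _ ≤ 8 * (|b| + |(ℓ : ℝ)|) * (2 * (B / (1 - r) * ‖x - y‖)) :=
        mul_le_mul h4 h3 (norm_nonneg _) (by positivity)
    _ = _ := by ring

set_option maxHeartbeats 1000000 in
/-- In every cylinder of size comparable to `κ / T`, with `T = |b| + |ℓ|`, two branches whose
logarithmic derivatives differ by a function with derivative bounded below cancel on a ball
of radius `ρ / T` around some point of the attractor: non-concentration makes the relative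
phase vary by at least `θ` between two points of the cylinder, while the arguments of `u`
along the two branches vary much less, so that the branches
cannot be aligned near both points. -/
theorem IsLogIFS.exists_cancellation (h : IsLogIFS f L ε r B c) {K : Set ℂ} (hKD : K ⊆ closedDisc)
    {δ m₁ A κ ρ θ η : ℝ} (hδ : 0 < δ) (hm : 0 < m₁) (hA : 0 < A)
    (hnc : ∀ (w : List (Fin n)) (e : ℂ), ∃ x ∈ K, ∃ y ∈ K,
      δ * ‖e‖ * ‖Complex.exp (wlog f L w 0)‖ ≤ |(e * (wcomp f w x - wcomp f w y)).re|)
    {N : ℕ} {w₁ w₂ : List (Fin n)} (hw₁ : w₁.length = N) (hw₂ : w₂.length = N)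
    (hm₁ : ∀ x ∈ closedDisc, m₁ ≤ ‖deriv (fun y => wlog f L w₁ y - wlog f L w₂ y) x‖)
    (hκ0 : 0 < κ) (hκ : 32 * (B / (1 - r)) * Real.exp (B / (1 - r)) * κ ≤ 1)
    (hθ : θ = δ * m₁ * Real.exp (-c - B / (1 - r)) * κ / 4)
    (hρ0 : 0 < ρ) (hρκ : ρ ≤ κ) (hρ : 32 * (B / (1 - r)) * ρ ≤ θ / 8)
    (hN : 64 * A * r ^ N * Real.exp (B / (1 - r)) * κ ≤ θ / 8)
    (hN' : A * r ^ N * (4 * Real.exp (B / (1 - r)) * κ) ≤ 1)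
    (hη : 0 ≤ η) (hη2 : η ≤ 1 / 2) (hηθ : 8 * η ≤ (θ / 16) ^ 2) :
    ∃ R : ℝ, ∀ (a b k : ℝ) (ℓ : ℤ), |a| ≤ 1 / 10 → 1 ≤ |b| + |(ℓ : ℝ)| → R ≤ |b| + |(ℓ : ℝ)| →
      2 * Real.pi * |a| * (c * N) ≤ k →
      ∀ (u : ℂ → ℂ) (H : ℂ → ℝ), Dominated u H (A * (|b| + |(ℓ : ℝ)|)) →
      (∀ x ∈ closedDisc, 0 < H x) → ∀ q₁ q₂ : ℝ, 0 < q₁ → 0 < q₂ → ∀ ξ : List (Fin n),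
      Real.exp (-c - B / (1 - r)) * (κ / (|b| + |(ℓ : ℝ)|)) ≤ ‖Complex.exp (wlog f L ξ 0)‖ →
      ‖Complex.exp (wlog f L ξ 0)‖ ≤ κ / (|b| + |(ℓ : ℝ)|) →
      ∃ x₀ ∈ K, ∀ x ∈ closedDisc, ‖x - wcomp f ξ x₀‖ ≤ ρ / (|b| + |(ℓ : ℝ)|) →
        ‖(q₁ : ℂ) * branch f L ((a : ℂ) + (b : ℂ) * Complex.I) ℓ k w₁ u x +
          (q₂ : ℂ) * branch f L ((a : ℂ) + (b : ℂ) * Complex.I) ℓ k w₂ u x‖ ≤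
        q₁ * H (wcomp f w₁ x) + q₂ * H (wcomp f w₂ x) -
          η * min (q₁ * H (wcomp f w₁ x)) (q₂ * H (wcomp f w₂ x)) := by
  set Λ := B / (1 - r) with hΛdef
  have hΛ : 0 ≤ Λ := h.distortion_nonneg
  set E := Real.exp Λ with hE
  have hE1 : 1 ≤ E := Real.one_le_exp hΛ
  set c₀ := Real.exp (-c - Λ) with hc₀
  have hc₀pos : 0 < c₀ := Real.exp_pos _
  have hθ0 : 0 < θ := by rw [hθ]; positivity
  have hη1 : 0 < 1 - η := by linarith
  obtain ⟨d, hd, hlin⟩ := exists_linearization (F := fun y => wlog f L w₁ y - wlog f L w₂ y)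
    isOpen_ball h.closedDisc_subset ((h.differentiableOn_wlog w₁).sub (h.differentiableOn_wlog w₂))
    (e := δ * m₁ / (64 * E)) (by positivity)
  refine ⟨2 * E * κ / d, ?_⟩
  intro a b k ℓ ha hT1 hTR hk u H hu hH q₁ q₂ hq₁ hq₂ ξ hξlow hξup
  set T := |b| + |(ℓ : ℝ)| with hTdef
  have hT : 0 < T := by linarith
  set lam := ‖Complex.exp (wlog f L ξ 0)‖ with hlam
  have hlam0 : 0 < lam := norm_pos_iff.mpr (Complex.exp_ne_zero _)
  set β : ℂ := ⟨-(2 * Real.pi * b), -(ℓ : ℝ)⟩ with hβ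
  set Δ : ℂ → ℂ := fun y => wlog f L w₁ y - wlog f L w₂ y with hΔ
  set Ψ : ℂ → ℝ := fun y => (β * Δ y).re with hΨ
  -- `z` is the centre of the cylinder
  set z := wcomp f ξ 0 with hz
  have hzD : z ∈ closedDisc := h.mapsD_wcomp ξ zero_mem_closedDisc
  obtain ⟨x₁, hx₁, y₁, hy₁, hxy⟩ := hnc ξ (β * deriv Δ z)
  set x := wcomp f ξ x₁ with hx
  set y := wcomp f ξ y₁ with hy
  have hxD : x ∈ closedDisc := h.mapsD_wcomp ξ (hKD hx₁)
  have hyD : y ∈ closedDisc := h.mapsD_wcomp ξ (hKD hy₁)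
  have hdistz : ∀ t ∈ K, ‖wcomp f ξ t - z‖ ≤ E * lam := by
    intro t ht
    refine (h.norm_wcomp_sub_le_deriv ξ (hKD ht) zero_mem_closedDisc).trans ?_
    have : ‖t - 0‖ ≤ 1 := by simpa [closedDisc] using hKD ht
    have h0 : 0 ≤ E * lam := by positivity
    nlinarith
  have hlamT : E * lam ≤ E * κ / T := by
    rw [mul_div_assoc]
    exact mul_le_mul_of_nonneg_left hξup (by positivity)
  have hsmall : E * κ / T < d := by
    rw [div_le_iff₀ hd] at hTR
    rw [div_lt_iff₀ hT]
    have : 0 < E * κ := by positivity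
    nlinarith
  have hxyd : ‖x - y‖ ≤ 2 * (E * lam) := by
    have e : x - y = (x - z) - (y - z) := by ring
    rw [e]
    refine (norm_sub_le _ _).trans ?_
    linarith [hdistz x₁ hx₁, hdistz y₁ hy₁]
  have hβlow : T / 2 ≤ ‖β‖ := le_norm_frequency b ℓ
  have hβup : ‖β‖ ≤ 8 * T := norm_frequency_le b ℓ
  -- the relative phase varies by at least `θ` and at most `1`
  have hΨlow : θ ≤ |Ψ x - Ψ y| := by
    have h1 := hlin x hxD y hyD z hzD (lt_of_le_of_lt ((hdistz x₁ hx₁).trans hlamT) hsmall)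
      (lt_of_le_of_lt ((hdistz y₁ hy₁).trans hlamT) hsmall)
    have h2 : (β * deriv Δ z * (x - y)).re =
        (Ψ x - Ψ y) - (β * (Δ x - Δ y - deriv Δ z * (x - y))).re := by
      simp only [hΨ]
      rw [← Complex.sub_re, ← Complex.sub_re]
      congr 1
      ring
    rw [h2] at hxy
    have h3 : |(β * (Δ x - Δ y - deriv Δ z * (x - y))).re| ≤
        8 * T * (δ * m₁ / (64 * E) * (2 * (E * lam))) := by
      refine (Complex.abs_re_le_norm _).trans ?_
      rw [norm_mul]
      refine mul_le_mul hβup (h1.trans ?_) (norm_nonneg _) (by positivity)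
      exact mul_le_mul_of_nonneg_left hxyd (by positivity)
    have h4 : 8 * T * (δ * m₁ / (64 * E) * (2 * (E * lam))) = T * δ * m₁ * lam / 4 := by
      field_simp
      ring
    have h5 : T * δ * m₁ * lam / 2 ≤ δ * ‖β * deriv Δ z‖ * lam := by
      rw [norm_mul]
      have h6 : T / 2 * m₁ ≤ ‖β‖ * ‖deriv Δ z‖ :=
        mul_le_mul hβlow (hm₁ z hzD) hm.le (norm_nonneg _)
      calc _ = δ * (T / 2 * m₁) * lam := by ring
        _ ≤ _ := by gcongr
    have h6 := abs_sub (Ψ x - Ψ y) (β * (Δ x - Δ y - deriv Δ z * (x - y))).re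
    have h7 : θ ≤ T * δ * m₁ * lam / 4 := by
      have h8 : c₀ * κ ≤ T * lam := by
        rw [← mul_div_assoc, div_le_iff₀ hT] at hξlow
        linarith
      rw [hθ]
      calc _ = δ * m₁ * (c₀ * κ) / 4 := by ring
        _ ≤ δ * m₁ * (T * lam) / 4 := by gcongr
        _ = _ := by ring
    linarith
  have hΨup : |Ψ x - Ψ y| ≤ 1 := by
    refine (h.norm_twist_wlog_sub_im_le w₁ w₂ hxD hyD).trans ?_
    rw [← hΛdef, ← hTdef]
    calc 16 * T * Λ * ‖x - y‖ ≤ 16 * T * Λ * (2 * (E * κ / T)) := by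
          gcongr
          linarith
      _ = 32 * Λ * E * κ := by field_simp; ring
      _ ≤ 1 := hκ
  by_contra! hcon
  -- two points without cancellation
  obtain ⟨x', hx'D, hx'x, hx'⟩ := hcon x₁ hx₁
  obtain ⟨y', hy'D, hy'y, hy'⟩ := hcon y₁ hy₁
  have hbr : ∀ (w : List (Fin n)), w.length = N → ∀ (q : ℝ), 0 < q → ∀ t ∈ closedDisc,
      ‖(q : ℂ) * branch f L ((a : ℂ) + (b : ℂ) * Complex.I) ℓ k w u t‖ ≤ q * ‖u (wcomp f w t)‖ := by
    intro w hw q hq t ht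
    rw [norm_mul, Complex.norm_real, Real.norm_of_nonneg hq.le, branch, norm_mul]
    refine mul_le_mul_of_nonneg_left ?_ hq.le
    have h1 := h.twist_re_le (a := a) (b := b) (ℓ := ℓ) (k := k) w (by rwa [hw])
      (h.closedDisc_subset ht)
    refine mul_le_of_le_one_left (norm_nonneg _) ?_
    rw [Complex.norm_exp]
    exact Real.exp_le_one_iff.mpr h1
  have hal : ∀ t ∈ closedDisc, q₁ * H (wcomp f w₁ t) + q₂ * H (wcomp f w₂ t) -
      η * min (q₁ * H (wcomp f w₁ t)) (q₂ * H (wcomp f w₂ t)) <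
      ‖(q₁ : ℂ) * branch f L ((a : ℂ) + (b : ℂ) * Complex.I) ℓ k w₁ u t +
          (q₂ : ℂ) * branch f L ((a : ℂ) + (b : ℂ) * Complex.I) ℓ k w₂ u t‖ →
      (1 - η) * H (wcomp f w₁ t) ≤ ‖u (wcomp f w₁ t)‖ ∧
      (1 - η) * H (wcomp f w₂ t) ≤ ‖u (wcomp f w₂ t)‖ ∧
      ‖Complex.exp (Complex.I * (((twist ((a : ℂ) + (b : ℂ) * Complex.I) ℓ
          (wlog f L w₁ t) - k).im : ℝ) : ℂ)) * (u (wcomp f w₁ t) / (‖u (wcomp f w₁ t)‖ : ℂ)) -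
        Complex.exp (Complex.I * (((twist ((a : ℂ) + (b : ℂ) * Complex.I) ℓ
          (wlog f L w₂ t) - k).im : ℝ) : ℂ)) *
            (u (wcomp f w₂ t) / (‖u (wcomp f w₂ t)‖ : ℂ))‖ ≤ θ / 16 := by
    intro t ht hlt
    have hD1 := h.mapsD_wcomp w₁ ht
    have hD2 := h.mapsD_wcomp w₂ ht
    have hb1 := hbr w₁ hw₁ q₁ hq₁ t ht
    have hb2 := hbr w₂ hw₂ q₂ hq₂ t ht
    have hu1 := hu.le _ hD1
    have hu2 := hu.le _ hD2
    obtain ⟨g1, g2, g3⟩ := aligned_of_lt (mul_pos hq₁ (hH _ hD1)) (mul_pos hq₂ (hH _ hD2)) hη hη2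
      (hb1.trans (mul_le_mul_of_nonneg_left hu1 hq₁.le))
      (hb2.trans (mul_le_mul_of_nonneg_left hu2 hq₂.le)) hlt
    refine ⟨?_, ?_, ?_⟩
    · have := g1.trans hb1
      rw [mul_left_comm] at this
      exact le_of_mul_le_mul_left this hq₁
    · have := g2.trans hb2
      rw [mul_left_comm] at this
      exact le_of_mul_le_mul_left this hq₂
    · rw [branch, branch, unit_exp_mul hq₁, unit_exp_mul hq₂] at g3
      exact abs_le_of_sq_le_sq' (g3.trans hηθ) (by positivity) |>.2
  obtain ⟨gx1, gx2, gx3⟩ := hal x' hx'D hx'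
  obtain ⟨gy1, gy2, gy3⟩ := hal y' hy'D hy'
  have hxy' : ‖x' - y'‖ ≤ 4 * E * κ / T := by
    have e : x' - y' = (x' - x) - (y' - y) + (x - y) := by ring
    rw [e]
    have h1 := norm_add_le ((x' - x) - (y' - y)) (x - y)
    have h2 := norm_sub_le (x' - x) (y' - y)
    have h3 : ρ / T ≤ E * κ / T := by
      gcongr
      nlinarith
    have h4 : 4 * E * κ / T = 4 * (E * κ / T) := by ring
    rw [h4]
    linarith
  -- the argument of `u` along a branch varies by at most `θ / 16`
  have hvar : ∀ (w : List (Fin n)), w.length = N →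
      (1 - η) * H (wcomp f w x') ≤ ‖u (wcomp f w x')‖ →
      (1 - η) * H (wcomp f w y') ≤ ‖u (wcomp f w y')‖ →
      ‖u (wcomp f w x') / (‖u (wcomp f w x')‖ : ℂ) -
        u (wcomp f w y') / (‖u (wcomp f w y')‖ : ℂ)‖ ≤ θ / 16 := by
    intro w hw g1 g2
    have hDx := h.mapsD_wcomp w hx'D
    have hDy := h.mapsD_wcomp w hy'D
    have hHx := hH _ hDx
    have hHy := hH _ hDy
    have hux : 0 < ‖u (wcomp f w x')‖ := (mul_pos hη1 hHx).trans_le g1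
    have huy : 0 < ‖u (wcomp f w y')‖ := (mul_pos hη1 hHy).trans_le g2
    refine (norm_unit_sub_unit_le (norm_pos_iff.mp hux) (norm_pos_iff.mp huy)).trans ?_
    rw [div_le_iff₀ huy]
    have h1 := hu.lip _ hDx _ hDy
    have h2 : A * T * ‖wcomp f w x' - wcomp f w y'‖ ≤ A * r ^ N * (4 * E * κ) := by
      have h3 := h.norm_wcomp_sub_le w (h.closedDisc_subset hx'D) (h.closedDisc_subset hy'D)
      rw [hw] at h3
      calc _ ≤ A * T * (r ^ N * (4 * E * κ / T)) := by
            have := pow_nonneg h.r_pos.le N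
            refine mul_le_mul_of_nonneg_left (h3.trans ?_) (by positivity)
            exact mul_le_mul_of_nonneg_left hxy' this
        _ = _ := by field_simp
    set q := A * r ^ N * (4 * E * κ) with hq
    have hq0 : 0 ≤ q := by
      have := pow_nonneg h.r_pos.le N
      positivity
    have h3 : Real.exp (A * T * ‖wcomp f w x' - wcomp f w y'‖) - 1 ≤ 2 * q := by
      have h4 := Real.exp_le_exp.mpr h2
      have h5 := Real.abs_exp_sub_one_le (x := q) (by rwa [abs_of_nonneg hq0])
      rw [abs_of_nonneg hq0] at h5
      linarith [le_abs_self (Real.exp q - 1)]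
    have h4 : ‖u (wcomp f w x') - u (wcomp f w y')‖ ≤ 2 * q * H (wcomp f w y') :=
      h1.trans (mul_le_mul_of_nonneg_right h3 hHy.le)
    have h5 : 16 * q ≤ θ / 8 := by
      calc _ = 64 * A * r ^ N * E * κ := by rw [hq]; ring
        _ ≤ _ := hN
    have h6 : H (wcomp f w y') ≤ 2 * ‖u (wcomp f w y')‖ := by
      have := mul_le_mul_of_nonneg_right hη2 hHy.le
      linarith
    calc 2 * ‖u (wcomp f w x') - u (wcomp f w y')‖ ≤ 2 * (2 * q * (2 * ‖u (wcomp f w y')‖)) := by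
          have : 2 * q * H (wcomp f w y') ≤ 2 * q * (2 * ‖u (wcomp f w y')‖) := by gcongr
          linarith
      _ = 8 * q * ‖u (wcomp f w y')‖ := by ring
      _ ≤ _ := by
          refine mul_le_mul_of_nonneg_right ?_ huy.le
          linarith
  have hu1 : ∀ t ∈ closedDisc, (1 - η) * H (wcomp f w₁ t) ≤ ‖u (wcomp f w₁ t)‖ →
      ‖u (wcomp f w₁ t) / (‖u (wcomp f w₁ t)‖ : ℂ)‖ = 1 := by
    intro t ht hle
    have := hH _ (h.mapsD_wcomp w₁ ht)
    exact norm_div_norm (norm_pos_iff.mp ((mul_pos hη1 this).trans_le hle))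
  have hfin := norm_exp_sub_exp_le_of_aligned (hu1 x' hx'D gx1) gx3 gy3
    (hvar w₁ hw₁ gx1 gy1) (hvar w₂ hw₂ gx2 gy2)
  have hphase : ∀ t, (twist ((a : ℂ) + (b : ℂ) * Complex.I) ℓ (wlog f L w₁ t) - k).im -
      (twist ((a : ℂ) + (b : ℂ) * Complex.I) ℓ (wlog f L w₂ t) - k).im = Ψ t := by
    intro t
    rw [Complex.sub_im, Complex.sub_im, sub_sub_sub_cancel_right, twist_im, twist_im,
      ← Complex.sub_re, ← mul_sub]
  rw [hphase, hphase] at hfin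
  have hmove : ∀ t ∈ closedDisc, ∀ t' ∈ closedDisc, ‖t - t'‖ ≤ ρ / T →
      ‖Complex.exp (Complex.I * (Ψ t : ℂ)) - Complex.exp (Complex.I * (Ψ t' : ℂ))‖ ≤ θ / 16 := by
    intro t ht t' ht' htt
    refine (norm_exp_I_sub_le _ _).trans
      ((h.norm_twist_wlog_sub_im_le w₁ w₂ ht ht').trans ?_)
    rw [← hΛdef, ← hTdef]
    calc 16 * T * Λ * ‖t - t'‖ ≤ 16 * T * Λ * (ρ / T) := by gcongr
      _ = 32 * Λ * ρ / 2 := by field_simp; ring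
      _ ≤ _ := by linarith
  have hlow := le_norm_exp_I_sub hΨup
  have h1 := hmove x' hx'D x hxD hx'x
  have h2 := hmove y' hy'D y hyD hy'y
  have e : Complex.exp (Complex.I * (Ψ x : ℂ)) - Complex.exp (Complex.I * (Ψ y : ℂ)) =
      (Complex.exp (Complex.I * (Ψ x' : ℂ)) - Complex.exp (Complex.I * (Ψ y' : ℂ))) -
      (Complex.exp (Complex.I * (Ψ x' : ℂ)) - Complex.exp (Complex.I * (Ψ x : ℂ))) +
      (Complex.exp (Complex.I * (Ψ y' : ℂ)) - Complex.exp (Complex.I * (Ψ y : ℂ))) := by ring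
  rw [e] at hlow
  have h3 := (norm_add_le _ _).trans (add_le_add (norm_sub_le
    (Complex.exp (Complex.I * (Ψ x' : ℂ)) - Complex.exp (Complex.I * (Ψ y' : ℂ)))
    (Complex.exp (Complex.I * (Ψ x' : ℂ)) - Complex.exp (Complex.I * (Ψ x : ℂ))))
    (le_refl ‖Complex.exp (Complex.I * (Ψ y' : ℂ)) - Complex.exp (Complex.I * (Ψ y : ℂ))‖))
  -- `θ / 2 ≤ 4 (θ / 16) + 2 (θ / 16)`, which is absurd
  linarith

/-! ### Averages over cylinders -/

lemma avg_iterate_succ_comp (m : ℕ) (F : ℂ → ℝ) (ξ : List (Fin n)) (x : ℂ) :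
    (avg f p)^[m + 1] (fun y => F (wcomp f ξ y)) x =
      ∑ a, p a * (avg f p)^[m] (fun y => F (wcomp f (a :: ξ) y)) x := by
  rw [Function.iterate_succ_apply]
  simp only [avg_iterate_eq, avg, Finset.mul_sum, wcomp]
  rw [Finset.sum_comm]
  exact Finset.sum_congr rfl fun a _ => Finset.sum_congr rfl fun w _ => by ring

lemma IsAttractor.exists_preimage {K : Set ℂ} (hK : IsAttractor f K) (l : ℕ) {x : ℂ}
    (hx : x ∈ K) : ∃ (τ : Fin l → Fin n), ∃ y ∈ K, wcomp f (List.ofFn τ) y = x := by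
  induction l with
  | zero => exact ⟨Fin.elim0, x, hx, by simp [wcomp]⟩
  | succ l ih =>
    obtain ⟨τ, y, hy, hyx⟩ := ih
    rw [hK.eq_iUnion] at hy
    obtain ⟨a, z, hz, rfl⟩ := mem_iUnion.mp hy
    exact ⟨Fin.cons a τ, z, hz, by rw [ofFn_cons]; exact hyx⟩

lemma pow_le_wprob {q : ℝ} (hq : 0 ≤ q) (hqp : ∀ a, q ≤ p a) {N : ℕ} (w : Fin N → Fin n) :
    q ^ N ≤ wprob p w := by
  have := Finset.prod_le_prod (s := (Finset.univ : Finset (Fin N))) (f := fun _ => q)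
    (g := fun i => p (w i)) (fun _ _ => hq) (fun i _ => hqp (w i))
  simpa [wprob] using this

/-- In a cylinder of size at most `t` with a subcylinder in `W`, averages of log-Lipschitz functions
see a definite proportion of `W`. -/
lemma IsLogIFS.le_avg_indicator_aux (h : IsLogIFS f L ε r B c) (hp : ∀ i, 0 < p i)
    (hp1 : ∑ i, p i = 1) {W : Set ℂ} {S : ℂ → ℝ} {σ t q : ℝ} {l : ℕ} (hσ : 0 ≤ σ)
    (hq : 0 ≤ q) (hqp : ∀ a, q ≤ p a)
    (hS : ∀ x ∈ closedDisc, 0 ≤ S x)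
    (hSl : ∀ x ∈ closedDisc, ∀ y ∈ closedDisc, S x ≤ Real.exp (σ * ‖x - y‖) * S y)
    {ξ : List (Fin n)}
    (hW : ∃ τ : Fin l → Fin n, ∀ y ∈ closedDisc, wcomp f (List.ofFn τ ++ ξ) y ∈ W)
    (hξ : ‖Complex.exp (wlog f L ξ 0)‖ ≤ t) {m : ℕ} (hm : l ≤ m) {x : ℂ} (hx : x ∈ closedDisc) :
    q ^ l * Real.exp (-(2 * (σ * (Real.exp (B / (1 - r)) * t)))) *
        (avg f p)^[m] (fun y => S (wcomp f ξ y)) x ≤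
      (avg f p)^[m] (fun y => W.indicator S (wcomp f ξ y)) x := by
  obtain ⟨τ, hτ⟩ := hW
  set D := σ * (Real.exp (B / (1 - r)) * t) with hD
  set z := wcomp f ξ 0 with hz
  have hzD : z ∈ closedDisc := h.mapsD_wcomp ξ zero_mem_closedDisc
  have hdist : ∀ y ∈ closedDisc, σ * ‖wcomp f ξ y - z‖ ≤ D := by
    intro y hy
    refine mul_le_mul_of_nonneg_left ?_ hσ
    refine (h.norm_wcomp_sub_le_deriv ξ hy zero_mem_closedDisc).trans ?_
    have h1 : ‖y - 0‖ ≤ 1 := by simpa [closedDisc] using hy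
    calc _ ≤ Real.exp (B / (1 - r)) * ‖Complex.exp (wlog f L ξ 0)‖ * 1 := by gcongr
      _ ≤ _ := by rw [mul_one]; gcongr
  have hup : ∀ y ∈ closedDisc, S (wcomp f ξ y) ≤ Real.exp D * S z := by
    intro y hy
    refine (hSl _ (h.mapsD_wcomp ξ hy) _ hzD).trans ?_
    exact mul_le_mul_of_nonneg_right (Real.exp_le_exp.mpr (hdist y hy)) (hS z hzD)
  have hlow : ∀ y ∈ closedDisc, Real.exp (-D) * S z ≤ S (wcomp f ξ y) := by
    intro y hy
    have h1 := hSl _ hzD _ (h.mapsD_wcomp ξ hy)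
    rw [norm_sub_rev] at h1
    rw [Real.exp_neg, inv_mul_le_iff₀ (Real.exp_pos _)]
    exact h1.trans (mul_le_mul_of_nonneg_right (Real.exp_le_exp.mpr (hdist y hy))
      (hS _ (h.mapsD_wcomp ξ hy)))
  have hind : ∀ y ∈ closedDisc, 0 ≤ W.indicator S (wcomp f ξ y) := fun y hy =>
    indicator_apply_nonneg fun _ => hS _ (h.mapsD_wcomp ξ hy)
  have hmass : ∀ y ∈ closedDisc, q ^ l * (Real.exp (-D) * S z) ≤
      (avg f p)^[l] (fun y => W.indicator S (wcomp f ξ y)) y := by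
    intro y hy
    rw [avg_iterate_eq]
    have hτy := h.mapsD_wcomp (List.ofFn τ) hy
    calc q ^ l * (Real.exp (-D) * S z)
        ≤ wprob p τ * W.indicator S (wcomp f ξ (wcomp f (List.ofFn τ) y)) := by
          refine mul_le_mul (pow_le_wprob hq hqp τ) ?_ (mul_nonneg (Real.exp_pos _).le (hS z hzD))
            (wprob_pos hp τ).le
          rw [indicator_of_mem (by rw [← wcomp_append]; exact hτ y hy)]
          exact hlow _ hτy
      _ ≤ _ := Finset.single_le_sum
          (f := fun w : Fin l → Fin n =>
            wprob p w * W.indicator S (wcomp f ξ (wcomp f (List.ofFn w) y)))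
          (fun w _ => mul_nonneg (wprob_pos hp w).le (hind _ (h.mapsD_wcomp _ hy)))
          (Finset.mem_univ τ)
  have h1 : (avg f p)^[m] (fun y => S (wcomp f ξ y)) x ≤ Real.exp D * S z := by
    rw [← avg_iterate_const (f := f) hp1 m (Real.exp D * S z) x]
    exact avg_iterate_mono h hp m hup hx
  have h2 : q ^ l * (Real.exp (-D) * S z) ≤
      (avg f p)^[m] (fun y => W.indicator S (wcomp f ξ y)) x := by
    obtain ⟨m', rfl⟩ := Nat.exists_eq_add_of_le hm
    rw [add_comm l m', Function.iterate_add_apply,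
      ← avg_iterate_const (f := f) hp1 m' (q ^ l * (Real.exp (-D) * S z)) x]
    exact avg_iterate_mono h hp m' hmass hx
  refine le_trans ?_ h2
  rw [show -(2 * D) = -D + -D by ring, Real.exp_add]
  have h3 : Real.exp (-D) * Real.exp D = 1 := by rw [← Real.exp_add]; simp
  calc _ ≤ q ^ l * (Real.exp (-D) * Real.exp (-D)) * (Real.exp D * S z) := by gcongr
    _ = q ^ l * (Real.exp (-D) * (Real.exp (-D) * Real.exp D) * S z) := by ring
    _ = _ := by rw [h3, mul_one]

/-- If every cylinder of size comparable to `t` contains a subcylinder of relative depth `l` inside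
`W`, then averages of log-Lipschitz functions over long words see a
definite proportion of `W`. The words are cut at the first time at which the derivative drops
below `t`. Cylinders may overlap, as all averages run over words. -/
theorem IsLogIFS.le_avg_indicator (h : IsLogIFS f L ε r B c) (hp : ∀ i, 0 < p i)
    (hp1 : ∑ i, p i = 1) {W : Set ℂ} {S : ℂ → ℝ} {σ t q : ℝ} {l : ℕ} (hσ : 0 ≤ σ)
    (hq : 0 ≤ q) (hqp : ∀ a, q ≤ p a)
    (hS : ∀ x ∈ closedDisc, 0 ≤ S x)
    (hSl : ∀ x ∈ closedDisc, ∀ y ∈ closedDisc, S x ≤ Real.exp (σ * ‖x - y‖) * S y)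
    (hW : ∀ ξ : List (Fin n), Real.exp (-c - B / (1 - r)) * t ≤ ‖Complex.exp (wlog f L ξ 0)‖ →
      ‖Complex.exp (wlog f L ξ 0)‖ ≤ t →
      ∃ τ : Fin l → Fin n, ∀ y ∈ closedDisc, wcomp f (List.ofFn τ ++ ξ) y ∈ W)
    (k : ℕ) (ξ : List (Fin n))
    (hξ : Real.exp (-c - B / (1 - r)) * t ≤ ‖Complex.exp (wlog f L ξ 0)‖)
    (hk : r ^ (ξ.length + k) ≤ t) (m : ℕ) (hm : k + l ≤ m) {x : ℂ} (hx : x ∈ closedDisc) :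
    q ^ l * Real.exp (-(2 * (σ * (Real.exp (B / (1 - r)) * t)))) *
        (avg f p)^[m] (fun y => S (wcomp f ξ y)) x ≤
      (avg f p)^[m] (fun y => W.indicator S (wcomp f ξ y)) x := by
  induction k generalizing ξ m with
  | zero =>
    have h1 : ‖Complex.exp (wlog f L ξ 0)‖ ≤ t :=
      (h.norm_exp_wlog_le ξ (h.closedDisc_subset zero_mem_closedDisc)).trans hk
    exact h.le_avg_indicator_aux hp hp1 hσ hq hqp hS hSl (hW ξ hξ h1) h1 (by omega) hx
  | succ k ih =>
    by_cases h1 : ‖Complex.exp (wlog f L ξ 0)‖ ≤ t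
    · exact h.le_avg_indicator_aux hp hp1 hσ hq hqp hS hSl (hW ξ hξ h1) h1 (by omega) hx
    · obtain ⟨m, rfl⟩ : ∃ m', m = m' + 1 := ⟨m - 1, by omega⟩
      rw [avg_iterate_succ_comp, avg_iterate_succ_comp, Finset.mul_sum]
      refine Finset.sum_le_sum fun a _ => ?_
      rw [mul_left_comm]
      refine mul_le_mul_of_nonneg_left (ih (a :: ξ) ?_ ?_ m (by omega)) (hp a).le
      · refine le_trans ?_ (h.norm_exp_wlog_cons_ge a ξ)
        exact mul_le_mul_of_nonneg_left (not_le.mp h1).le (Real.exp_pos _).le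
      · rw [List.length_cons, show ξ.length + 1 + k = ξ.length + (k + 1) by ring]
        exact hk

/-! ### The contraction in mean square -/

lemma sq_sum_sub_le {ι : Type*} [Fintype ι] {q G : ι → ℝ} (hq : ∀ i, 0 ≤ q i)
    (hq1 : ∑ i, q i = 1) (i : ι) {η : ℝ} (hη : 0 ≤ η) (hη1 : η ≤ 1) :
    (∑ w, q w * G w - η * (q i * G i)) ^ 2 ≤ (1 - η * q i) * ∑ w, q w * G w ^ 2 := by
  classical
  set A : ι → ℝ := fun w => if w = i then 1 - η else 1 with hA
  have h1 : ∑ w, q w * G w - η * (q i * G i) = ∑ w, q w * (A w * G w) := by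
    have : ∀ w, q w * (A w * G w) = q w * G w - if w = i then η * (q w * G w) else 0 := by
      intro w
      by_cases hw : w = i
      · simp only [hA, hw, if_true]; ring
      · simp only [hA, hw, if_false]; ring
    simp only [this, Finset.sum_sub_distrib, Finset.sum_ite_eq', Finset.mem_univ, if_true]
  have h2 : ∑ w, q w * A w ^ 2 = 1 - q i * (1 - (1 - η) ^ 2) := by
    have : ∀ w, q w * A w ^ 2 = q w - if w = i then q w * (1 - (1 - η) ^ 2) else 0 := by
      intro w
      by_cases hw : w = i
      · simp only [hA, hw, if_true]; ring
      · simp only [hA, hw, if_false]; ring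
    simp only [this, Finset.sum_sub_distrib, Finset.sum_ite_eq', Finset.mem_univ, if_true, hq1]
  rw [h1]
  refine (sq_sum_mul_le Finset.univ q A G fun i _ => hq i).trans ?_
  refine mul_le_mul_of_nonneg_right ?_
    (Finset.sum_nonneg fun w _ => mul_nonneg (hq w) (sq_nonneg _))
  rw [h2]
  nlinarith [hq i, mul_nonneg (hq i) (mul_nonneg hη (sub_nonneg.mpr hη1))]

lemma sq_sum_sub_min_le {ι : Type*} [Fintype ι] {q G : ι → ℝ} (hq : ∀ i, 0 ≤ q i)
    (hq1 : ∑ i, q i = 1) (i j : ι) {η q₀ : ℝ} (hη : 0 ≤ η) (hη1 : η ≤ 1)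
    (hi : q₀ ≤ q i) (hj : q₀ ≤ q j) :
    (∑ w, q w * G w - η * min (q i * G i) (q j * G j)) ^ 2 ≤
      (1 - η * q₀) * ∑ w, q w * G w ^ 2 := by
  have hS : 0 ≤ ∑ w, q w * G w ^ 2 :=
    Finset.sum_nonneg fun w _ => mul_nonneg (hq w) (sq_nonneg _)
  rcases le_total (q i * G i) (q j * G j) with h | h
  · rw [min_eq_left h]
    refine (sq_sum_sub_le hq hq1 i hη hη1).trans (mul_le_mul_of_nonneg_right ?_ hS)
    have := mul_le_mul_of_nonneg_left hi hη
    linarith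
  · rw [min_eq_right h]
    refine (sq_sum_sub_le hq hq1 j hη hη1).trans (mul_le_mul_of_nonneg_right ?_ hS)
    have := mul_le_mul_of_nonneg_left hj hη
    linarith

/-! ### The Dolgopyat step -/

/-- The new majorant: the two distinguished words are replaced by `pairMajorant`. -/
noncomputable def stepMajorant (f L : Fin n → ℂ → ℂ) (p : Fin n → ℝ) (s : ℂ) (ℓ : ℤ) (k η : ℝ)
    {N : ℕ} (w₁ w₂ : Fin N → Fin n) (u : ℂ → ℂ) (H : ℂ → ℝ) : ℂ → ℝ :=
  fun x => pairMajorant η (fun x => (wprob p w₁ : ℂ) * branch f L s ℓ k (List.ofFn w₁) u x)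
      (fun x => (wprob p w₂ : ℂ) * branch f L s ℓ k (List.ofFn w₂) u x)
      (fun x => wprob p w₁ * H (wcomp f (List.ofFn w₁) x))
      (fun x => wprob p w₂ * H (wcomp f (List.ofFn w₂) x)) x +
    ∑ w ∈ (Finset.univ.erase w₁).erase w₂, wprob p w * H (wcomp f (List.ofFn w) x)

lemma add_sum_erase_erase {ι M : Type*} [Fintype ι] [DecidableEq ι] [AddCommMonoid M] {i j : ι}
    (hij : i ≠ j) (F : ι → M) :
    F i + F j + ∑ w ∈ (Finset.univ.erase i).erase j, F w = ∑ w, F w := by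
  rw [add_assoc, Finset.add_sum_erase _ F (Finset.mem_erase.mpr ⟨hij.symm, Finset.mem_univ j⟩),
    Finset.add_sum_erase _ F (Finset.mem_univ i)]

section step

variable {a b k σ η : ℝ} {ℓ : ℤ} {N : ℕ} {w₁ w₂ : Fin N → Fin n} {u : ℂ → ℂ} {H : ℂ → ℝ}

lemma Dominated.step (h : IsLogIFS f L ε r B c) (hp : ∀ i, 0 < p i) (hw : w₁ ≠ w₂)
    (ha : |a| ≤ 1 / 10) (hT : 1 ≤ |b| + |(ℓ : ℝ)|) (hk : 2 * Real.pi * |a| * (c * N) ≤ k)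
    (hσ : 0 ≤ σ) (hη : 0 ≤ η) (hη1 : η ≤ 1) (hu : Dominated u H σ) :
    Dominated (fun x => (Real.exp (-k) : ℂ) *
        (transfer f p ((a : ℂ) + (b : ℂ) * Complex.I) ℓ)^[N] u x)
      (stepMajorant f L p ((a : ℂ) + (b : ℂ) * Complex.I) ℓ k η w₁ w₂ u H)
      (2 * (σ * r ^ N + 8 * (|b| + |(ℓ : ℝ)|) * (B / (1 - r)))) := by
  have hr0 := pow_nonneg h.r_pos.le N
  have hΛ := h.distortion_nonneg
  set σ' := σ * r ^ N + 8 * (|b| + |(ℓ : ℝ)|) * (B / (1 - r)) with hσ'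
  have hσ'0 : 0 ≤ σ' := by positivity
  have hb : ∀ w : Fin N → Fin n, Dominated (fun x => (wprob p w : ℂ) *
      ConformalIFS.branch f L ((a : ℂ) + (b : ℂ) * Complex.I) ℓ k (List.ofFn w) u x)
      (fun x => wprob p w * H (wcomp f (List.ofFn w) x)) σ' := by
    intro w
    have h2 := hu.branch h ha hT (List.ofFn w) (k := k) (by simpa using hk) hσ
    rw [List.length_ofFn] at h2
    exact h2.const_mul (wprob_pos hp w).le
  have h1 := ((hb w₁).pair (hb w₂) hσ'0 hη hη1).add ((Dominated.sum
    ((Finset.univ.erase w₁).erase w₂) fun w _ => hb w).mono (by linarith : σ' ≤ 2 * σ'))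
  refine h1.congr fun x hx => ?_
  rw [h.transfer_iterate_eq_branch _ _ _ _ _ (h.closedDisc_subset hx),
    ← add_sum_erase_erase hw]

lemma stepMajorant_pos (h : IsLogIFS f L ε r B c) (hp : ∀ i, 0 < p i) (hη : η ≤ 1)
    (hH : ∀ x ∈ closedDisc, 0 < H x)
    {s : ℂ} {x : ℂ} (hx : x ∈ closedDisc) : 0 < stepMajorant f L p s ℓ k η w₁ w₂ u H x := by
  have h1 : ∀ w : Fin N → Fin n, 0 < wprob p w * H (wcomp f (List.ofFn w) x) := fun w =>
    mul_pos (wprob_pos hp w) (hH _ (h.mapsD_wcomp _ hx))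
  refine add_pos_of_pos_of_nonneg (lt_of_lt_of_le ?_ (le_max_right _ _))
    (Finset.sum_nonneg fun w _ => (h1 w).le)
  have h2 := min_le_left (wprob p w₁ * H (wcomp f (List.ofFn w₁) x))
    (wprob p w₂ * H (wcomp f (List.ofFn w₂) x))
  have h3 := lt_min (h1 w₁) (h1 w₂)
  have h4 := h1 w₂
  nlinarith

/-- The majorant contracts in mean square on the set where the two branches cancel. -/
lemma sq_stepMajorant_le (h : IsLogIFS f L ε r B c) (hp : ∀ i, 0 < p i) (hp1 : ∑ i, p i = 1)
    (hw : w₁ ≠ w₂) (hη : 0 ≤ η) (hη1 : η ≤ 1) {q : ℝ} (hq : 0 ≤ q) (hqp : ∀ i, q ≤ p i)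
    (ha : |a| ≤ 1 / 10) (hT : 1 ≤ |b| + |(ℓ : ℝ)|) (hk : 2 * Real.pi * |a| * (c * N) ≤ k)
    (hσ : 0 ≤ σ) (hu : Dominated u H σ) {W : Set ℂ}
    (hW : ∀ x ∈ W, ‖(wprob p w₁ : ℂ) *
          branch f L ((a : ℂ) + (b : ℂ) * Complex.I) ℓ k (List.ofFn w₁) u x +
        (wprob p w₂ : ℂ) *
          branch f L ((a : ℂ) + (b : ℂ) * Complex.I) ℓ k (List.ofFn w₂) u x‖ ≤
      wprob p w₁ * H (wcomp f (List.ofFn w₁) x) + wprob p w₂ * H (wcomp f (List.ofFn w₂) x) -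
        η * min (wprob p w₁ * H (wcomp f (List.ofFn w₁) x))
          (wprob p w₂ * H (wcomp f (List.ofFn w₂) x)))
    {x : ℂ} (hx : x ∈ closedDisc) :
    stepMajorant f L p ((a : ℂ) + (b : ℂ) * Complex.I) ℓ k η w₁ w₂ u H x ^ 2 ≤
      (avg f p)^[N] (fun y => H y ^ 2) x -
        η * q ^ N * W.indicator ((avg f p)^[N] (fun y => H y ^ 2)) x := by
  classical
  have hS : ∀ w : Fin N → Fin n, 0 ≤ wprob p w := fun w => (wprob_pos hp w).le
  have hHnn : ∀ w : Fin N → Fin n, 0 ≤ wprob p w * H (wcomp f (List.ofFn w) x) := fun w =>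
    mul_nonneg (hS w) (hu.nonneg _ (h.mapsD_wcomp _ hx))
  have hsum := add_sum_erase_erase hw (fun w : Fin N → Fin n =>
    wprob p w * H (wcomp f (List.ofFn w) x))
  have hrest : 0 ≤ ∑ w ∈ (Finset.univ.erase w₁).erase w₂,
      wprob p w * H (wcomp f (List.ofFn w) x) := Finset.sum_nonneg fun w _ => hHnn w
  have hnn : 0 ≤ stepMajorant f L p ((a : ℂ) + (b : ℂ) * Complex.I) ℓ k η w₁ w₂ u H x :=
    add_nonneg (le_max_of_le_left (norm_nonneg _)) hrest
  by_cases hxW : x ∈ W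
  · rw [indicator_of_mem hxW, avg_iterate_eq]
    have h1 : stepMajorant f L p ((a : ℂ) + (b : ℂ) * Complex.I) ℓ k η w₁ w₂ u H x =
        ∑ w : Fin N → Fin n, wprob p w * H (wcomp f (List.ofFn w) x) -
        η * min (wprob p w₁ * H (wcomp f (List.ofFn w₁) x))
          (wprob p w₂ * H (wcomp f (List.ofFn w₂) x)) := by
      rw [stepMajorant, pairMajorant, max_eq_right (hW x hxW), ← hsum]
      ring
    rw [h1]
    have h2 := sq_sum_sub_min_le (q := fun w : Fin N → Fin n => wprob p w)
      (G := fun w => H (wcomp f (List.ofFn w) x)) hS (sum_wprob hp1 N) w₁ w₂ hη hη1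
      (pow_le_wprob hq hqp w₁) (pow_le_wprob hq hqp w₂)
    linarith
  · rw [indicator_of_notMem hxW, mul_zero, sub_zero]
    refine le_trans ?_ (sq_avg_iterate_le hp hp1 N H x)
    refine pow_le_pow_left₀ hnn ?_ 2
    have hb : ∀ w : Fin N → Fin n, Dominated (fun x => (wprob p w : ℂ) *
        branch f L ((a : ℂ) + (b : ℂ) * Complex.I) ℓ k (List.ofFn w) u x)
        (fun x => wprob p w * H (wcomp f (List.ofFn w) x)) _ := fun w =>
      (hu.branch h ha hT (List.ofFn w) (k := k) (by simpa using hk) hσ).const_mul (hS w)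
    rw [avg_iterate_eq, ← hsum]
    have hb1 := hb w₁
    have hb2 := hb w₂
    rw [List.length_ofFn] at hb1 hb2
    exact add_le_add (pairMajorant_le hb1 hb2 hη hx) le_rfl

end step

set_option maxHeartbeats 1000000 in
/-- The Dolgopyat step. One application of a fixed power `N` of the normalized transfer
operator preserves domination, and can be accompanied by a majorant which is contracted in
mean square, the mean being over all words of a length proportional to `log T`. -/
theorem IsLogIFS.exists_step (h : IsLogIFS f L ε r B c) {j : Fin 4 → Fin n}
    (hj : Function.Injective j) (huni : UNI f j) {K : Set ℂ} (hK : IsAttractor f K)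
    (hcurve : ¬ ∃ M : Set ℂ, IsAnalyticCurve M ∧ K ⊆ M)
    (hp : ∀ i, 0 < p i) (hp1 : ∑ i, p i = 1) :
    ∃ (N l : ℕ) (A κ R d : ℝ), 0 < N ∧ 1 ≤ A ∧ 0 < κ ∧ 0 < d ∧ d < 1 ∧
      16 * (B / (1 - r)) ≤ A ∧
      ∀ (a b k : ℝ) (ℓ : ℤ), |a| ≤ 1 / 10 → 1 ≤ |b| + |(ℓ : ℝ)| → R ≤ |b| + |(ℓ : ℝ)| →
      2 * Real.pi * |a| * (c * N) ≤ k →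
      ∀ (u : ℂ → ℂ) (H : ℂ → ℝ), Dominated u H (A * (|b| + |(ℓ : ℝ)|)) →
      (∀ x ∈ closedDisc, 0 < H x) →
      ∃ H' : ℂ → ℝ, Dominated (fun x => (Real.exp (-k) : ℂ) *
          (transfer f p ((a : ℂ) + (b : ℂ) * Complex.I) ℓ)^[N] u x) H'
          (A * (|b| + |(ℓ : ℝ)|)) ∧
        (∀ x ∈ closedDisc, 0 < H' x) ∧
        ∀ m M : ℕ, r ^ m ≤ κ / (|b| + |(ℓ : ℝ)|) → m + l ≤ M → ∀ x ∈ closedDisc,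
          (avg f p)^[M] (fun y => H' y ^ 2) x ≤
            (1 - d) * (avg f p)^[M + N] (fun y => H y ^ 2) x := by
  obtain ⟨δ, hδ, hnc⟩ := h.exists_nonconcentration hK hcurve
  obtain ⟨m₁, hm₁, hder⟩ := h.exists_le_norm_deriv_sub huni
  have hc : 0 ≤ c := h.c_nonneg (j 0)
  obtain ⟨q, hq, hqp⟩ : ∃ q : ℝ, 0 < q ∧ ∀ i, q ≤ p i := by
    have : Nonempty (Fin n) := ⟨j 0⟩
    obtain ⟨i, hi⟩ := Finite.exists_min p
    exact ⟨p i, hp i, hi⟩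
  set Λ := B / (1 - r) with hΛdef
  have hΛ : 0 ≤ Λ := h.distortion_nonneg
  set E := Real.exp Λ with hE
  have hE1 : 1 ≤ E := Real.one_le_exp hΛ
  set A := 16 * Λ + 2 with hA
  have hA0 : 0 < A := by positivity
  set κ := 1 / (32 * Λ * E + 1) with hκdef
  have hκ0 : 0 < κ := by positivity
  have hκ1 : κ ≤ 1 := by
    rw [hκdef, div_le_one (by positivity)]
    have : 0 ≤ 32 * Λ * E := by positivity
    linarith
  have hκ : 32 * Λ * E * κ ≤ 1 := by
    rw [hκdef, mul_one_div, div_le_one (by positivity)]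
    linarith
  set θ := δ * m₁ * Real.exp (-c - Λ) * κ / 4 with hθ
  have hθ0 : 0 < θ := by positivity
  set ρ := min κ (θ / (256 * Λ + 1)) with hρdef
  have hρ0 : 0 < ρ := lt_min hκ0 (by positivity)
  have hρ : 32 * Λ * ρ ≤ θ / 8 := by
    calc 32 * Λ * ρ ≤ 32 * Λ * (θ / (256 * Λ + 1)) := by
          gcongr
          exact min_le_right _ _
      _ ≤ θ / 8 := by
          rw [← mul_div_assoc, div_le_div_iff₀ (by positivity) (by norm_num)]
          nlinarith
  set η := min (1 / 2) (θ ^ 2 / 2048) with hηdef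
  have hη0 : 0 < η := lt_min (by norm_num) (by positivity)
  have hη2 : η ≤ 1 / 2 := min_le_left _ _
  have hηθ : 8 * η ≤ (θ / 16) ^ 2 := by
    have : η ≤ θ ^ 2 / 2048 := min_le_right _ _
    nlinarith
  -- the number of iterates in one step
  obtain ⟨N', hN'⟩ := exists_pow_lt_of_lt_one
    (x := min (1 / (4 * A * E)) (θ / (512 * A * E))) (lt_min (by positivity) (by positivity)) h.r_lt
  set N := N' + 1 with hNdef
  have hrN : r ^ N ≤ min (1 / (4 * A * E)) (θ / (512 * A * E)) :=
    (pow_le_pow_of_le_one h.r_pos.le h.r_lt.le (Nat.le_succ N')).trans hN'.le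
  have hrN0 : 0 < r ^ N := pow_pos h.r_pos N
  have hrN1 : r ^ N * (4 * A * E) ≤ 1 := by
    rw [← le_div_iff₀ (by positivity)]
    exact hrN.trans (min_le_left _ _)
  have hrN2 : r ^ N * (512 * A * E) ≤ θ := by
    rw [← le_div_iff₀ (by positivity)]
    exact hrN.trans (min_le_right _ _)
  have hNa : 64 * A * r ^ N * E * κ ≤ θ / 8 := by
    calc 64 * A * r ^ N * E * κ ≤ 64 * A * r ^ N * E * 1 := by gcongr
      _ ≤ θ / 8 := by linarith
  have hNb : A * r ^ N * (4 * E * κ) ≤ 1 := by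
    calc A * r ^ N * (4 * E * κ) ≤ A * r ^ N * (4 * E * 1) := by gcongr
      _ ≤ 1 := by linarith
  have hNc : A * r ^ N ≤ 1 := by
    refine le_trans ?_ hrN1
    have : 0 ≤ A * r ^ N := by positivity
    nlinarith
  -- the two distinguished words
  set v₁ : Fin N → Fin n := Fin.cons (j 0) (fun _ : Fin N' => j 0) with hv₁
  set v₂ : Fin N → Fin n := Fin.cons (j 1) (fun _ : Fin N' => j 0) with hv₂
  have hv : v₁ ≠ v₂ := by
    intro heq
    have h1 : v₁ 0 = v₂ 0 := by rw [heq]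
    simp only [hv₁, hv₂, Fin.cons_zero] at h1
    exact absurd (hj h1) (by decide)
  have hder' : ∀ x ∈ closedDisc,
      m₁ ≤ ‖deriv (fun y => wlog f L (List.ofFn v₁) y - wlog f L (List.ofFn v₂) y) x‖ := by
    rw [hv₁, hv₂, ofFn_cons, ofFn_cons]
    exact hder _
  obtain ⟨R, hR⟩ := h.exists_cancellation hK.subset hδ hm₁ hA0 hnc (N := N)
    (w₁ := List.ofFn v₁) (w₂ := List.ofFn v₂) (List.length_ofFn) (List.length_ofFn) hder' hκ0 hκ hθ
    hρ0 (min_le_left _ _) hρ hNa hNb hη0.le hη2 hηθ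
  -- the depth at which subcylinders fit into the balls of cancellation
  obtain ⟨l, hl⟩ := exists_pow_lt_of_lt_one (x := ρ / (2 * E * κ)) (by positivity) h.r_lt
  set d := min (1 / 2)
    (η * q ^ N * (q ^ l * Real.exp (-(2 * (2 * A * (E * κ)))))) with hd
  refine ⟨N, l, A, κ, R, d, Nat.succ_pos _, by linarith, hκ0, lt_min (by norm_num) (by positivity),
    lt_of_le_of_lt (min_le_left _ _) (by norm_num), by linarith, ?_⟩
  intro a b k ℓ ha hT1 hTR hk u H hu hH
  set T := |b| + |(ℓ : ℝ)| with hTdef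
  have hT : 0 < T := by linarith
  have hAT : 0 ≤ A * T := by positivity
  refine ⟨stepMajorant f L p ((a : ℂ) + (b : ℂ) * Complex.I) ℓ k η v₁ v₂ u H,
    (hu.step h hp hv ha hT1 hk hAT hη0.le (by linarith)).mono ?_,
    fun x hx => stepMajorant_pos h hp (by linarith) hH hx, ?_⟩
  · rw [← hΛdef, ← hTdef]
    have h1 : A * r ^ N * T ≤ 1 * T := by gcongr
    rw [hA] at h1 ⊢
    linarith
  intro m M hm hM x hx
  set S : ℂ → ℝ := (avg f p)^[N] (fun y => H y ^ 2) with hS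
  set W : Set ℂ := {x | x ∈ closedDisc ∧ ‖(wprob p v₁ : ℂ) *
          branch f L ((a : ℂ) + (b : ℂ) * Complex.I) ℓ k (List.ofFn v₁) u x +
        (wprob p v₂ : ℂ) *
          branch f L ((a : ℂ) + (b : ℂ) * Complex.I) ℓ k (List.ofFn v₂) u x‖ ≤
      wprob p v₁ * H (wcomp f (List.ofFn v₁) x) + wprob p v₂ * H (wcomp f (List.ofFn v₂) x) -
        η * min (wprob p v₁ * H (wcomp f (List.ofFn v₁) x))
          (wprob p v₂ * H (wcomp f (List.ofFn v₂) x))} with hWdef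
  have hSnn : ∀ y ∈ closedDisc, 0 ≤ S y := by
    intro y _
    rw [hS, avg_iterate_eq]
    exact Finset.sum_nonneg fun w _ => mul_nonneg (wprob_pos hp w).le (sq_nonneg _)
  have hSl : ∀ y ∈ closedDisc, ∀ z ∈ closedDisc,
      S y ≤ Real.exp (2 * (A * T) * ‖y - z‖) * S z := by
    intro y hy z hz
    rw [hS, avg_iterate_eq, avg_iterate_eq, Finset.mul_sum]
    refine Finset.sum_le_sum fun w _ => ?_
    rw [mul_left_comm]
    refine mul_le_mul_of_nonneg_left ?_ (wprob_pos hp w).le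
    have hyD := h.mapsD_wcomp (List.ofFn w) hy
    have hzD := h.mapsD_wcomp (List.ofFn w) hz
    have h1 := hu.log_lip _ hyD _ hzD
    have h2 : ‖wcomp f (List.ofFn w) y - wcomp f (List.ofFn w) z‖ ≤ ‖y - z‖ := by
      refine (h.norm_wcomp_sub_le _ (h.closedDisc_subset hy) (h.closedDisc_subset hz)).trans ?_
      exact mul_le_of_le_one_left (norm_nonneg _) (pow_le_one₀ h.r_pos.le h.r_lt.le)
    have h3 : Real.exp (A * T * ‖wcomp f (List.ofFn w) y - wcomp f (List.ofFn w) z‖) ≤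
        Real.exp (A * T * ‖y - z‖) :=
      Real.exp_le_exp.mpr (mul_le_mul_of_nonneg_left h2 hAT)
    have h4 := h1.trans (mul_le_mul_of_nonneg_right h3 (hH _ hzD).le)
    have h5 := pow_le_pow_left₀ (hH _ hyD).le h4 2
    rw [mul_pow, ← Real.exp_nat_mul] at h5
    convert h5 using 3
    push_cast
    ring
  have hWc : ∀ ξ : List (Fin n),
      Real.exp (-c - B / (1 - r)) * (κ / T) ≤ ‖Complex.exp (wlog f L ξ 0)‖ →
      ‖Complex.exp (wlog f L ξ 0)‖ ≤ κ / T →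
      ∃ τ : Fin l → Fin n, ∀ y ∈ closedDisc, wcomp f (List.ofFn τ ++ ξ) y ∈ W := by
    intro ξ hξ1 hξ2
    obtain ⟨x₀, hx₀, hgood⟩ := hR a b k ℓ ha hT1 hTR hk u H hu hH (wprob p v₁) (wprob p v₂)
      (wprob_pos hp _) (wprob_pos hp _) ξ hξ1 hξ2
    obtain ⟨τ, y₀, hy₀, hτ⟩ := hK.exists_preimage l hx₀
    refine ⟨τ, fun y hy => ⟨h.mapsD_wcomp _ hy, hgood _ (h.mapsD_wcomp _ hy) ?_⟩⟩
    rw [wcomp_append, ← hτ]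
    have hy₀D := hK.subset hy₀
    have h1 := h.norm_wcomp_sub_le_deriv ξ (h.mapsD_wcomp (List.ofFn τ) hy)
      (h.mapsD_wcomp (List.ofFn τ) hy₀D)
    have h2 := h.norm_wcomp_sub_le (List.ofFn τ) (h.closedDisc_subset hy)
      (h.closedDisc_subset hy₀D)
    rw [List.length_ofFn] at h2
    have h3 : ‖y - y₀‖ ≤ 2 := by
      have e1 : ‖y‖ ≤ 1 := by simpa [closedDisc] using hy
      have e2 : ‖y₀‖ ≤ 1 := by simpa [closedDisc] using hy₀D
      linarith [norm_sub_le y y₀]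
    rw [lt_div_iff₀ (by positivity)] at hl
    have hrl := pow_nonneg h.r_pos.le l
    calc _ ≤ _ := h1
      _ ≤ E * (κ / T) * (r ^ l * 2) := by
          refine mul_le_mul ?_ (h2.trans ?_) (norm_nonneg _) (by positivity)
          · exact mul_le_mul_of_nonneg_left hξ2 (by positivity)
          · exact mul_le_mul_of_nonneg_left h3 hrl
      _ = r ^ l * (2 * E * κ) / T := by ring
      _ ≤ ρ / T := by gcongr
  have hκT : κ / T ≤ 1 := by
    rw [div_le_one hT]
    linarith
  have hmain := h.le_avg_indicator hp hp1 (W := W) (S := S) (σ := 2 * (A * T)) (t := κ / T)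
    (by positivity) hq.le hqp hSnn hSl hWc m []
    (by
      simp only [wlog, Complex.exp_zero, norm_one]
      have h1 : Real.exp (-c - B / (1 - r)) ≤ 1 := Real.exp_le_one_iff.mpr (by
        rw [← hΛdef]; linarith)
      have h2 : 0 ≤ κ / T := by positivity
      nlinarith [Real.exp_pos (-c - B / (1 - r))])
    (by simpa using hm) M hM hx
  have hconst : 2 * (A * T) * (Real.exp (B / (1 - r)) * (κ / T)) = 2 * A * (E * κ) := by
    rw [← hΛdef, ← hE]
    field_simp
  rw [hconst] at hmain
  simp only [wcomp] at hmain
  have hSM : (avg f p)^[M + N] (fun y => H y ^ 2) x = (avg f p)^[M] S x := by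
    rw [Function.iterate_add_apply]
  rw [hSM]
  have hSM0 : 0 ≤ (avg f p)^[M] S x := by
    rw [avg_iterate_eq]
    exact Finset.sum_nonneg fun w _ =>
      mul_nonneg (wprob_pos hp w).le (hSnn _ (h.mapsD_wcomp _ hx))
  have h1 := avg_iterate_mono h hp M (fun y hy =>
    sq_stepMajorant_le h hp hp1 hv hη0.le (by linarith) hq.le hqp ha hT1 hk hAT hu (W := W)
      (fun z hz => hz.2) hy) hx
  refine h1.trans ?_
  rw [avg_iterate_sub, avg_iterate_const_mul]
  have h2 : d * (avg f p)^[M] S x ≤ η * q ^ N * (avg f p)^[M] (fun y => W.indicator S y) x := by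
    calc d * (avg f p)^[M] S x ≤
          η * q ^ N * (q ^ l * Real.exp (-(2 * (2 * A * (E * κ))))) * (avg f p)^[M] S x :=
          mul_le_mul_of_nonneg_right (min_le_right _ _) hSM0
      _ = η * q ^ N * (q ^ l * Real.exp (-(2 * (2 * A * (E * κ)))) * (avg f p)^[M] S x) := by ring
      _ ≤ _ := mul_le_mul_of_nonneg_left hmain (by positivity)
  change (avg f p)^[M] S x - η * q ^ N * (avg f p)^[M] (fun y => W.indicator S y) x ≤ _
  linarith

/-! ### The space `C¹(D)` -/

lemma uniqueDiffOn_closedDisc : UniqueDiffOn ℝ closedDisc :=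
  uniqueDiffOn_convex convex_closedDisc
    (by rw [closedDisc, interior_closedBall _ one_ne_zero]; exact ⟨0, by simp⟩)

lemma contDiff_twist (s : ℂ) (ℓ : ℤ) : ContDiff ℝ 1 (twist s ℓ) := by
  unfold twist
  have h1 : ContDiff ℝ 1 fun z : ℂ => ((z.re : ℝ) : ℂ) :=
    Complex.ofRealCLM.contDiff.comp Complex.reCLM.contDiff
  have h2 : ContDiff ℝ 1 fun z : ℂ => ((z.im : ℝ) : ℂ) :=
    Complex.ofRealCLM.contDiff.comp Complex.imCLM.contDiff
  exact (contDiff_const.mul h1).neg.add (contDiff_const.mul h2)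

lemma IsLogIFS.contDiffOn_of_differentiableOn (h : IsLogIFS f L ε r B c) {g : ℂ → ℂ}
    (hg : DifferentiableOn ℂ g (ball 0 (1 + ε))) : ContDiffOn ℝ 1 g closedDisc :=
  ((hg.contDiffOn isOpen_ball (n := 1)).restrict_scalars ℝ).mono h.closedDisc_subset

lemma IsLogIFS.isC1_transfer (h : IsLogIFS f L ε r B c) (s : ℂ) (ℓ : ℤ) {g : ℂ → ℂ}
    (hg : IsC1 g) : IsC1 (transfer f p s ℓ g) := by
  have h1 : ContDiffOn ℝ 1
      (fun x => ∑ a, (p a : ℂ) * (Complex.exp (twist s ℓ (L a x)) * g (f a x))) closedDisc := by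
    refine ContDiffOn.sum fun a _ => contDiffOn_const.mul (ContDiffOn.mul ?_ ?_)
    · exact ((contDiff_twist s ℓ).comp_contDiffOn
        (h.contDiffOn_of_differentiableOn (h.diffL a))).cexp
    · exact ContDiffOn.comp hg (h.contDiffOn_of_differentiableOn (h.diff a)) (h.mapsD a)
  exact h1.congr fun x hx => h.transfer_eq s ℓ g (h.closedDisc_subset hx)

lemma IsLogIFS.isC1_transfer_iterate (h : IsLogIFS f L ε r B c) (s : ℂ) (ℓ : ℤ) {g : ℂ → ℂ}
    (hg : IsC1 g) (N : ℕ) : IsC1 ((transfer f p s ℓ)^[N] g) := by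
  induction N with
  | zero => exact hg
  | succ N ih =>
    rw [Function.iterate_succ_apply']
    exact h.isC1_transfer s ℓ ih

lemma IsC1.continuousOn_fderivWithin {g : ℂ → ℂ} (hg : IsC1 g) :
    ContinuousOn (fun x => fderivWithin ℝ g closedDisc x) closedDisc :=
  ContDiffOn.continuousOn_fderivWithin hg uniqueDiffOn_closedDisc le_rfl

lemma IsC1.bound {g : ℂ → ℂ} (hg : IsC1 g) {x : ℂ} (hx : x ∈ closedDisc) :
    ‖g x‖ ≤ c1Norm g ∧ ‖fderivWithin ℝ g closedDisc x‖ ≤ c1Norm g := by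
  have b1 : BddAbove ((fun x => ‖g x‖) '' closedDisc) :=
    (isCompact_closedDisc.image_of_continuousOn
      (ContDiffOn.continuousOn hg).norm).bddAbove
  have b2 : BddAbove ((fun x => ‖fderivWithin ℝ g closedDisc x‖) '' closedDisc) :=
    (isCompact_closedDisc.image_of_continuousOn hg.continuousOn_fderivWithin.norm).bddAbove
  have h1 := le_csSup b1 (mem_image_of_mem _ hx)
  have h2 := le_csSup b2 (mem_image_of_mem _ hx)
  rw [c1Norm]
  constructor
  · linarith [norm_nonneg (fderivWithin ℝ g closedDisc x)]
  · linarith [norm_nonneg (g x)]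

lemma IsC1.lipschitz {g : ℂ → ℂ} (hg : IsC1 g) {x y : ℂ} (hx : x ∈ closedDisc)
    (hy : y ∈ closedDisc) : ‖g x - g y‖ ≤ c1Norm g * ‖x - y‖ :=
  convex_closedDisc.norm_image_sub_le_of_norm_fderivWithin_le
    (ContDiffOn.differentiableOn hg one_ne_zero) (fun _ hz => (hg.bound hz).2) hy hx

lemma IsC1.dominated_const {g : ℂ → ℂ} (hg : IsC1 g) {σ k : ℝ} (hσ : 1 ≤ σ) (hk : c1Norm g ≤ k) :
    Dominated g (fun _ => k) σ := by
  have hk0 : 0 ≤ k := (norm_nonneg _).trans ((hg.bound zero_mem_closedDisc).1.trans hk)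
  refine ⟨fun _ _ => hk0, fun x hx => (hg.bound hx).1.trans hk, fun x _ y _ => ?_,
    fun x hx y hy => ?_⟩
  · exact le_mul_of_one_le_left hk0 (Real.one_le_exp (by positivity))
  · refine (hg.lipschitz hx hy).trans ?_
    have h1 := Real.add_one_le_exp (σ * ‖x - y‖)
    have h2 : ‖x - y‖ ≤ Real.exp (σ * ‖x - y‖) - 1 := by
      nlinarith [norm_nonneg (x - y)]
    rw [mul_comm]
    calc _ ≤ ‖x - y‖ * k := by gcongr
      _ ≤ _ := by gcongr

lemma norm_fderiv_le_of_exp_lip {g : ℂ → ℂ} {x : ℂ} (hx : closedDisc ∈ 𝓝 x) {σ M : ℝ}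
    (hσ : 0 ≤ σ) (hM : 0 ≤ M)
    (hl : ∀ y ∈ closedDisc, ‖g y - g x‖ ≤ (Real.exp (σ * ‖y - x‖) - 1) * M) :
    ‖fderiv ℝ g x‖ ≤ σ * M := by
  -- the difference quotients of `t ↦ e^{σ t} - 1` at `0` tend to `σ`
  refine le_of_forall_pos_le_add fun e he => ?_
  have hd : HasDerivAt (fun t : ℝ => Real.exp (σ * t)) σ 0 := by
    simpa using! ((hasDerivAt_id (0 : ℝ)).const_mul σ).exp
  have h1 := hd.isLittleO.def (show 0 < e / (M + 1) by positivity)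
  have h2 : Tendsto (fun y : ℂ => ‖y - x‖) (𝓝 x) (𝓝 0) := by
    have : Continuous fun y : ℂ => ‖y - x‖ := by fun_prop
    simpa using this.tendsto x
  refine norm_fderiv_le_of_lip' ℝ (by positivity) ?_
  filter_upwards [hx, h2.eventually h1] with y hy h3
  simp only [mul_zero, Real.exp_zero, sub_zero, smul_eq_mul, norm_norm] at h3
  have h4 := (le_abs_self _).trans h3
  refine (hl y hy).trans ?_
  have h5 : e / (M + 1) * M ≤ e := by
    rw [div_mul_eq_mul_div, div_le_iff₀ (by positivity)]
    nlinarith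
  calc (Real.exp (σ * ‖y - x‖) - 1) * M
      ≤ (‖y - x‖ * σ + e / (M + 1) * ‖y - x‖) * M := by
        refine mul_le_mul_of_nonneg_right ?_ hM
        linarith
    _ = (σ * M + e / (M + 1) * M) * ‖y - x‖ := by ring
    _ ≤ _ := by gcongr

lemma IsC1.c1Norm_le {g : ℂ → ℂ} (hg : IsC1 g) {σ M : ℝ} (hσ : 0 ≤ σ) (hM : 0 ≤ M)
    (hb : ∀ x ∈ closedDisc, ‖g x‖ ≤ M)
    (hl : ∀ x ∈ closedDisc, ∀ y ∈ closedDisc,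
      ‖g x - g y‖ ≤ (Real.exp (σ * ‖x - y‖) - 1) * M) :
    c1Norm g ≤ (1 + σ) * M := by
  have hne : closedDisc.Nonempty := ⟨0, zero_mem_closedDisc⟩
  have h1 : sSup ((fun x => ‖g x‖) '' closedDisc) ≤ M := by
    refine csSup_le (hne.image _) ?_
    rintro _ ⟨x, hx, rfl⟩
    exact hb x hx
  have h2 : sSup ((fun x => ‖fderivWithin ℝ g closedDisc x‖) '' closedDisc) ≤ σ * M := by
    refine csSup_le (hne.image _) ?_
    rintro _ ⟨x, hx, rfl⟩
    -- by continuity it suffices to consider interior points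
    have hint : closure (ball (0 : ℂ) 1) = closedDisc := closure_ball 0 one_ne_zero
    have hcl : x ∈ closure (ball (0 : ℂ) 1) := by rwa [hint]
    refine closure_minimal (s := ball (0 : ℂ) 1)
      (t := closedDisc ∩ {x | ‖fderivWithin ℝ g closedDisc x‖ ≤ σ * M}) ?_ ?_ hcl |>.2
    · intro y hy
      have hyn : closedDisc ∈ 𝓝 y :=
        mem_of_superset (isOpen_ball.mem_nhds hy) ball_subset_closedBall
      refine ⟨ball_subset_closedBall hy, ?_⟩
      rw [mem_ofPred_eq, fderivWithin_of_mem_nhds hyn]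
      exact norm_fderiv_le_of_exp_lip hyn hσ hM fun z hz => hl z hz y (ball_subset_closedBall hy)
    · have := (hg.continuousOn_fderivWithin.norm).preimage_isClosed_of_isClosed
        isCompact_closedDisc.isClosed (isClosed_Iic (a := σ * M))
      exact this
  rw [c1Norm]
  linarith

/-! ### The norm estimate -/

lemma transfer_const_mul (s : ℂ) (ℓ : ℤ) (k : ℂ) (g : ℂ → ℂ) :
    transfer f p s ℓ (fun x => k * g x) = fun x => k * transfer f p s ℓ g x := by
  funext x
  simp only [transfer, Finset.mul_sum]
  exact Finset.sum_congr rfl fun a _ => by ring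

lemma transfer_iterate_const_mul (s : ℂ) (ℓ : ℤ) (k : ℂ) (g : ℂ → ℂ) (N : ℕ) :
    (transfer f p s ℓ)^[N] (fun x => k * g x) = fun x => k * (transfer f p s ℓ)^[N] g x := by
  induction N with
  | zero => rfl
  | succ N ih =>
    rw [Function.iterate_succ_apply', ih, transfer_const_mul, Function.iterate_succ_apply']

/-- Iterating the Dolgopyat step gives exponential decay in mean square of the majorants. -/
lemma IsLogIFS.exists_majorant_iterate (h : IsLogIFS f L ε r B c) (hp : ∀ i, 0 < p i)
    (hp1 : ∑ i, p i = 1) {s : ℂ} {ℓ : ℤ} {N M₀ : ℕ} {σ k d : ℝ} (hd : d ≤ 1)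
    (hstep : ∀ (u : ℂ → ℂ) (H : ℂ → ℝ), Dominated u H σ → (∀ x ∈ closedDisc, 0 < H x) →
      ∃ H' : ℂ → ℝ, Dominated (fun x => (Real.exp (-k) : ℂ) * (transfer f p s ℓ)^[N] u x) H' σ ∧
        (∀ x ∈ closedDisc, 0 < H' x) ∧
        ∀ M : ℕ, M₀ ≤ M → ∀ x ∈ closedDisc,
          (avg f p)^[M] (fun y => H' y ^ 2) x ≤
            (1 - d) * (avg f p)^[M + N] (fun y => H y ^ 2) x)
    {g : ℂ → ℂ} {t : ℝ} (ht : 0 < t) (hg : Dominated g (fun _ => t) σ) (i : ℕ) :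
    ∃ H : ℂ → ℝ, Dominated (fun x => (Real.exp (-(k * i)) : ℂ) *
        (transfer f p s ℓ)^[i * N] g x) H σ ∧ (∀ x ∈ closedDisc, 0 < H x) ∧
      ∀ M : ℕ, M₀ ≤ M → ∀ x ∈ closedDisc,
        (avg f p)^[M] (fun y => H y ^ 2) x ≤ (1 - d) ^ i * t ^ 2 := by
  induction i with
  | zero =>
    refine ⟨fun _ => t, by simpa using hg, fun _ _ => ht, fun M _ x _ => ?_⟩
    rw [avg_iterate_const hp1]
    simp
  | succ i ih =>
    obtain ⟨H, hH1, hH2, hH3⟩ := ih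
    obtain ⟨H', h1, h2, h3⟩ := hstep _ H hH1 hH2
    refine ⟨H', h1.congr fun x _ => ?_, h2, fun M hM x hx => ?_⟩
    · rw [transfer_iterate_const_mul, ← Function.iterate_add_apply, ← mul_assoc,
        ← Complex.ofReal_mul, ← Real.exp_add]
      rw [show -k + -(k * i) = -(k * ((i + 1 : ℕ) : ℝ)) by push_cast; ring,
        show N + i * N = (i + 1) * N by ring]
    · refine (h3 M hM x hx).trans ?_
      rw [pow_succ, mul_comm ((1 - d) ^ i), mul_assoc]
      refine mul_le_mul_of_nonneg_left ?_ (by linarith)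
      rw [add_comm M N, Function.iterate_add_apply,
        ← avg_iterate_const (f := f) hp1 N ((1 - d) ^ i * t ^ 2) x]
      exact avg_iterate_mono h hp N (hH3 M hM) hx

end ConformalIFS

open ConformalIFS in
theorem theorem2p3 {n : ℕ} (f : Fin n → ℂ → ℂ) (hf : ConformalIFS.IsHolomorphicIFS f)
    (j : Fin 4 → Fin n) (hj : Function.Injective j)
    (hsep : ConformalIFS.Separated f j) (huni : ConformalIFS.UNI f j)
    (K : Set ℂ) (hK : ConformalIFS.IsAttractor f K)
    (hcurve : ¬ ∃ M : Set ℂ, ConformalIFS.IsAnalyticCurve M ∧ K ⊆ M)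
    (p : Fin n → ℝ) (hp : ∀ i, 0 < p i) (hp1 : ∑ i, p i = 1) :
    ∃ C γ ε R α : ℝ, 0 < C ∧ 0 < γ ∧ 0 < ε ∧ 0 < R ∧ 0 < α ∧ α < 1 ∧
      ∀ (a b : ℝ) (ℓ : ℤ), |a| < ε → R < |b| + |(ℓ : ℝ)| → ∀ N : ℕ, 0 < N →
        ConformalIFS.C1OpNormLE
          ((ConformalIFS.transfer f p ((a : ℂ) + (b : ℂ) * Complex.I) ℓ)^[N])
          (C * (|b| + |(ℓ : ℝ)|) ^ (1 + γ) * α ^ N) := by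
  obtain ⟨L, ε₀, r, B, c, h⟩ := hf.exists_isLogIFS
  obtain ⟨N, l, A, κ, R, d, hN, hA, hκ, hd0, hd1, hAΛ, hstep⟩ :=
    h.exists_step hj huni hK hcurve hp hp1
  have hc := h.c_nonneg (j 0)
  have hΛ := h.distortion_nonneg
  -- the decay rate per iterate is `q = (1 - d) ^ (1 / (2 N))`
  have hN' : (0 : ℝ) < N := by exact_mod_cast hN
  obtain ⟨q, hq0, hq1, hqN⟩ : ∃ q : ℝ, 0 < q ∧ q < 1 ∧
      ∀ i : ℕ, (q ^ (i * N)) ^ 2 = (1 - d) ^ i := by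
    refine ⟨(1 - d) ^ ((1 : ℝ) / (2 * N)), Real.rpow_pos_of_pos (by linarith) _,
      Real.rpow_lt_one (by linarith) (by linarith) (by positivity), fun i => ?_⟩
    rw [← pow_mul, ← Real.rpow_natCast, ← Real.rpow_mul (by linarith), ← Real.rpow_natCast]
    congr 1
    push_cast
    field_simp
  set α := (1 + q) / 2 with hα
  have hα0 : 0 < α := by linarith
  have hαq : 1 < α / q := by rw [one_lt_div hq0]; linarith
  have hlogr : 0 < -Real.log r := neg_pos.mpr (Real.log_neg h.r_pos h.r_lt)
  have hlogq : 0 < -Real.log q := neg_pos.mpr (Real.log_neg hq0 hq1)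
  set γ := -Real.log q / -Real.log r with hγ
  have hγ0 : 0 < γ := div_pos hlogq hlogr
  have hpi := Real.pi_pos
  refine ⟨3 * A * κ ^ (-γ) * (q⁻¹) ^ (1 + l + N), γ,
    min (1 / 10) (Real.log (α / q) / (2 * Real.pi * c + 1)), max R (max 1 κ), α, by positivity, hγ0,
    lt_min (by norm_num) (div_pos (Real.log_pos hαq) (by positivity)),
    lt_max_of_lt_right (lt_max_of_lt_left one_pos), hα0, by linarith, ?_⟩
  intro a b ℓ ha hT N₁ _ g hg
  set T := |b| + |(ℓ : ℝ)| with hTdef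
  have hTR : R ≤ T := (le_max_left _ _).trans hT.le
  have hT1 : 1 ≤ T := (le_max_left _ _).trans ((le_max_right _ _).trans hT.le)
  have hTκ : κ ≤ T := (le_max_right _ _).trans ((le_max_right _ _).trans hT.le)
  have hT0 : 0 < T := by linarith
  have ha1 : |a| ≤ 1 / 10 := ha.le.trans (min_le_left _ _)
  have haε : 2 * Real.pi * |a| * c ≤ Real.log (α / q) := by
    have h1 := ha.le.trans (min_le_right _ _)
    rw [le_div_iff₀ (by positivity)] at h1
    nlinarith [abs_nonneg a]
  have hC1 := h.isC1_transfer_iterate (p := p) ((a : ℂ) + (b : ℂ) * Complex.I) ℓ hg N₁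
  refine ⟨hC1, ?_⟩
  -- the length of words needed to resolve the scale `κ / T`
  set m := ⌈Real.log (T / κ) / -Real.log r⌉₊ with hm
  have hTκ1 : 1 ≤ T / κ := by rwa [one_le_div hκ]
  have hrm : r ^ m ≤ κ / T := by
    rw [← Real.log_le_log_iff (pow_pos h.r_pos m) (by positivity), Real.log_pow]
    have h1 := Nat.le_ceil (Real.log (T / κ) / -Real.log r)
    rw [div_le_iff₀ hlogr, ← hm] at h1
    have h2 : Real.log (κ / T) = -Real.log (T / κ) := by rw [← Real.log_inv, inv_div]
    rw [h2]
    linarith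
  have hqm : (q⁻¹) ^ m ≤ (T / κ) ^ γ * q⁻¹ := by
    have h1 := (Nat.ceil_lt_add_one (div_nonneg (Real.log_nonneg hTκ1) hlogr.le)).le
    rw [← hm] at h1
    rw [← Real.log_le_log_iff (by positivity) (by positivity), Real.log_pow, Real.log_inv,
      Real.log_mul (by positivity) (by positivity), Real.log_rpow (by positivity), Real.log_inv]
    calc (m : ℝ) * -Real.log q ≤ (Real.log (T / κ) / -Real.log r + 1) * -Real.log q := by gcongr
      _ = γ * Real.log (T / κ) + -Real.log q := by rw [hγ]; ring
  -- split the iterates into Dolgopyat steps and an averaging part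
  obtain ⟨i, m₁, hi1, hi2, hi3⟩ : ∃ i m₁ : ℕ, N₁ = m₁ + i * N ∧ (i = 0 ∨ m + l ≤ m₁) ∧
      N₁ ≤ i * N + (m + l + N) := by
    by_cases hlt : N₁ < m + l
    · exact ⟨0, N₁, by simp, Or.inl rfl, by omega⟩
    · have h1 := Nat.div_add_mod (N₁ - (m + l)) N
      have h2 := Nat.mod_lt (N₁ - (m + l)) hN
      rw [mul_comm] at h1
      refine ⟨(N₁ - (m + l)) / N, N₁ - (N₁ - (m + l)) / N * N, ?_, Or.inr ?_, ?_⟩ <;> omega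
  have hAT1 : 1 ≤ A * T := by nlinarith
  have hstep' : ∀ (u : ℂ → ℂ) (H : ℂ → ℝ), Dominated u H (A * T) →
      (∀ x ∈ closedDisc, 0 < H x) → ∃ H' : ℂ → ℝ, Dominated (fun x =>
        (Real.exp (-(2 * Real.pi * |a| * (c * N))) : ℂ) *
          (transfer f p ((a : ℂ) + (b : ℂ) * Complex.I) ℓ)^[N] u x) H' (A * T) ∧
        (∀ x ∈ closedDisc, 0 < H' x) ∧
        ∀ M : ℕ, m + l ≤ M → ∀ x ∈ closedDisc,
          (avg f p)^[M] (fun y => H' y ^ 2) x ≤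
            (1 - d) * (avg f p)^[M + N] (fun y => H y ^ 2) x := by
    intro u H hu hH
    obtain ⟨H', e1, e2, e3⟩ :=
      hstep a b (2 * Real.pi * |a| * (c * N)) ℓ ha1 hT1 hTR le_rfl u H hu hH
    exact ⟨H', e1, e2, fun M hM => e3 m M hrm hM⟩
  have hbound : ∀ t : ℝ, c1Norm g < t →
      c1Norm ((transfer f p ((a : ℂ) + (b : ℂ) * Complex.I) ℓ)^[N₁] g) ≤
        (1 + 2 * A * T) * (Real.exp (2 * Real.pi * |a| * c * N₁) * q ^ (i * N)) * t := by
    intro t ht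
    have ht0 : 0 < t := lt_of_le_of_lt
      ((norm_nonneg _).trans (hg.bound zero_mem_closedDisc).1) ht
    have hg0 : Dominated g (fun _ => t) (A * T) := hg.dominated_const hAT1 ht.le
    obtain ⟨H, hH1, hH2, hH3⟩ : ∃ H : ℂ → ℝ, Dominated (fun x =>
        (Real.exp (-(2 * Real.pi * |a| * (c * N) * i)) : ℂ) *
          (transfer f p ((a : ℂ) + (b : ℂ) * Complex.I) ℓ)^[i * N] g x) H (A * T) ∧
        (∀ x ∈ closedDisc, 0 < H x) ∧
        ∀ x ∈ closedDisc, (avg f p)^[m₁] (fun y => H y ^ 2) x ≤ (1 - d) ^ i * t ^ 2 := by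
      rcases hi2 with rfl | hi2
      · refine ⟨fun _ => t, by simpa using hg0, fun _ _ => ht0, fun x _ => ?_⟩
        rw [avg_iterate_const hp1]
        simp
      · obtain ⟨H, e1, e2, e3⟩ := h.exists_majorant_iterate hp hp1 hd1.le hstep' ht0 hg0 i
        exact ⟨H, e1, e2, e3 m₁ hi2⟩
    have hdom := hH1.transfer_iterate h hp ha1 hT1 m₁ (k := 2 * Real.pi * |a| * (c * m₁)) le_rfl
      (by linarith)
    have hsmall : ∀ x ∈ closedDisc, (avg f p)^[m₁] H x ≤ q ^ (i * N) * t := by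
      intro x hx
      have h1 := (sq_avg_iterate_le (f := f) hp hp1 m₁ H x).trans (hH3 x hx)
      rw [← hqN, ← mul_pow] at h1
      exact abs_le_of_sq_le_sq' h1 (by positivity) |>.2
    have heq : ∀ x, (transfer f p ((a : ℂ) + (b : ℂ) * Complex.I) ℓ)^[N₁] g x =
        (Real.exp (2 * Real.pi * |a| * c * N₁) : ℂ) *
          ((Real.exp (-(2 * Real.pi * |a| * (c * m₁))) : ℂ) *
          (transfer f p ((a : ℂ) + (b : ℂ) * Complex.I) ℓ)^[m₁] (fun x =>
            (Real.exp (-(2 * Real.pi * |a| * (c * N) * i)) : ℂ) *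
          (transfer f p ((a : ℂ) + (b : ℂ) * Complex.I) ℓ)^[i * N] g x) x) := by
      intro x
      rw [transfer_iterate_const_mul, ← Function.iterate_add_apply, ← mul_assoc, ← mul_assoc,
        ← Complex.ofReal_mul, ← Complex.ofReal_mul, ← Real.exp_add, ← Real.exp_add, ← hi1]
      have : 2 * Real.pi * |a| * c * N₁ + -(2 * Real.pi * |a| * (c * m₁)) +
          -(2 * Real.pi * |a| * (c * N) * i) = 0 := by
        rw [hi1]
        push_cast
        ring
      rw [this]
      simp
    set Q := Real.exp (2 * Real.pi * |a| * c * N₁) with hQ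
    have hQ0 : 0 < Q := Real.exp_pos _
    have hrm1 : r ^ m₁ ≤ 1 := pow_le_one₀ h.r_pos.le h.r_lt.le
    have hslope : A * T * r ^ m₁ + 8 * T * (B / (1 - r)) ≤ 2 * A * T := by
      have : A * T * r ^ m₁ ≤ A * T * 1 := by gcongr
      have h2 : 16 * (B / (1 - r)) * T ≤ A * T := by gcongr
      nlinarith
    have hdom' := hdom.mono hslope
    rw [mul_assoc]
    refine hC1.c1Norm_le (by positivity) (by positivity) (fun x hx => ?_) (fun x hx y hy => ?_)
    · rw [heq x, norm_mul, Complex.norm_real, Real.norm_of_nonneg hQ0.le, mul_assoc Q _ t]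
      exact mul_le_mul_of_nonneg_left ((hdom'.le x hx).trans (hsmall x hx)) hQ0.le
    · rw [heq x, heq y, ← mul_sub, norm_mul, Complex.norm_real, Real.norm_of_nonneg hQ0.le]
      have h1 : 0 ≤ Real.exp (2 * A * T * ‖x - y‖) - 1 := by
        linarith [Real.one_le_exp (by positivity : 0 ≤ 2 * A * T * ‖x - y‖)]
      calc _ ≤ Q * ((Real.exp (2 * A * T * ‖x - y‖) - 1) * (q ^ (i * N) * t)) :=
            mul_le_mul_of_nonneg_left ((hdom'.lip x hx y hy).trans
              (mul_le_mul_of_nonneg_left (hsmall y hy) h1)) hQ0.le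
        _ = _ := by ring
  have hY0 : 0 < (1 + 2 * A * T) * (Real.exp (2 * Real.pi * |a| * c * N₁) * q ^ (i * N)) := by
    positivity
  have hlim : c1Norm ((transfer f p ((a : ℂ) + (b : ℂ) * Complex.I) ℓ)^[N₁] g) ≤
      (1 + 2 * A * T) * (Real.exp (2 * Real.pi * |a| * c * N₁) * q ^ (i * N)) * c1Norm g := by
    rw [← div_le_iff₀' hY0]
    refine le_of_forall_gt_imp_ge_of_dense fun t ht => ?_
    rw [div_le_iff₀' hY0]
    exact hbound t ht
  refine hlim.trans (mul_le_mul_of_nonneg_right ?_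
    ((norm_nonneg _).trans (hg.bound zero_mem_closedDisc).1))
  have hexp : Real.exp (2 * Real.pi * |a| * c * N₁) ≤ (α / q) ^ N₁ := by
    rw [mul_comm, Real.exp_nat_mul]
    refine pow_le_pow_left₀ (Real.exp_pos _).le ?_ _
    rw [← Real.le_log_iff_exp_le (by positivity)]
    exact haε
  have hqi : q ^ (i * N) ≤ q ^ N₁ * (q⁻¹) ^ (m + l + N) := by
    rw [inv_pow, ← div_eq_mul_inv, le_div_iff₀ (by positivity), ← pow_add]
    exact pow_le_pow_of_le_one hq0.le hq1.le hi3
  have hαN : (α / q) ^ N₁ * q ^ N₁ = α ^ N₁ := by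
    rw [← mul_pow, div_mul_cancel₀ _ hq0.ne']
  have hTγ : (T / κ) ^ γ = T ^ γ * κ ^ (-γ) := by
    rw [Real.div_rpow hT0.le hκ.le, Real.rpow_neg hκ.le, div_eq_mul_inv]
  calc (1 + 2 * A * T) * (Real.exp (2 * Real.pi * |a| * c * N₁) * q ^ (i * N))
      ≤ (3 * A * T) * ((α / q) ^ N₁ * (q ^ N₁ * (q⁻¹) ^ (m + l + N))) := by
        gcongr
        linarith
    _ = 3 * A * T * ((α / q) ^ N₁ * q ^ N₁) * ((q⁻¹) ^ m * (q⁻¹) ^ (l + N)) := by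
        rw [add_assoc m l N, pow_add]
        ring
    _ ≤ 3 * A * T * ((α / q) ^ N₁ * q ^ N₁) * ((T / κ) ^ γ * q⁻¹ * (q⁻¹) ^ (l + N)) := by
        gcongr
    _ = _ := by
        rw [hαN, hTγ, Real.rpow_add hT0, Real.rpow_one, add_assoc 1 l N, pow_add q⁻¹ 1 (l + N),
          pow_one]
        ring
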